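/- Let $k$ be a field of characteristic $0$. Let $(L,\mathfrak g)$ be a $(\Theta,\Delta)$-graded Lie algebra over $k$. This means the following. $\mathfrak g\subseteq L$ is a finite-dimensional split semisimple subalgebra with splitting Cartan subalgebra $\mathfrak h$ and root system $\Delta$ of $(\mathfrak g,\mathfrak h)$. $\Theta\subset\mathfrak h^*$ is a finite root system (not necessarily reduced or irreducible) containing $\Delta$ such that every reduced connected component of $\Theta$ lies in $\Delta$, and for every non-reduced component $\Theta_c=\Theta_{c,1}\cup\Theta_{c,2}\cup\Theta_{c,4}$ (of type $BC_n$, with roots of square length $1,2,4$) the set $\Delta\cap\Theta_c$ is either $\Theta_{c,1}\cup\Theta_{c,2}$ or $\Theta_{c,2}\cup\Theta_{c,4}$. With $L_\alpha=\{l\in L:[h,l]=\alpha(h)l\ \forall h\in\mathfrak h\}$ one has $L=\sum_{\alpha\in\Theta\cup\{0\}}L_\alpha$ and $L_0=\sum_{\alpha\in\Theta}[L_\alpha,L_{-\alpha}]$. Fix a root basis $\{\alpha_i\}_{i\in I}$ of $\Delta$ with coroots $h_i$, root vectors $e_i\in\mathfrak g_{\alpha_i}$, $f_i\in\mathfrak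 g_{-\alpha_i}$ with $[e_i,f_i]=h_i$, and a positive system $\Theta_+$ of $\Theta$ with $\Theta_+\cap\Delta=\Delta_+$. Let $\mathbb N[\Theta_+]\subset\mathfrak h^*$ be the additive monoid spanned by $\Theta_+$, and $L_+=\bigoplus_{\alpha\in\Theta_+}L_\alpha$. Let $\lambda\in\mathfrak h^*$ be dominant integral, $\lambda(h_i)=\ell_i\in\mathbb N$ for all $i\in I$. * $\mathcal I^\lambda=\mathcal I(L,\mathfrak g)^\lambda$ is the full subcategory of the category of $L$-modules consisting of the $V$ that are integrable over $\mathfrak g$ (all $e_i,f_i$ act locally nilpotently) and whose $\mathfrak h$-weights all lie in $\lambda-\mathbb N[\Theta_+]$. * Let $U(L)_0$ be the centralizer of $\mathfrak h$ in $U(L)$ and $\pi_0\colon U(L)_0=U(L_0)\oplus K\to U(L_0)$ the projection with kernel $K=U(L)L_+\cap U(L)_0$. The Seligman algebra is $\mathcal S^\lambda=U(L_0)/J^\lambda$, where $J^\lambda$ is the two-sided ideal generated by all $h_i-\ell_i$ and all $\pi_0(x_1\cdots x_m\,y_1\cdots y_{\ell_i+1})$ with $i\in I$, $x_j\in L_{\beta_j}$,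 $\beta_j\in\Theta_+$, $\sum_j\beta_j=(\ell_i+1)\alpha_i$, $y_j\in L_{-\alpha_i}$. * For an $\mathcal S^\lambda$-module $M$, viewed as an $(L_0\oplus L_+)$-module with $L_+M=0$, put $\widetilde M=U(L)\otimes_{U(L_0\oplus L_+)}M$, $\widetilde N=\sum_{i\in I}\sum_{m\in M}U(L)(f_i^{\ell_i+1}\otimes m)$ and $\mathbf I(M)=\widetilde M/\widetilde N$. For an $\mathcal S^\lambda$-linear map $f$ let $\mathbf I(f)$ be the map induced by $\mathrm{Id}\otimes f$. Then: 1. For every $V\in\mathcal I^\lambda$ the ideal $J^\lambda$ annihilates the weight space $V_\lambda$, so that $\mathbf R\colon\mathcal I^\lambda\to\mathcal S^\lambda\text{-}\mathrm{Mod}$, $V\mapsto V_\lambda$, $\varphi\mapsto\varphi|_{V_\lambda}$, is a functor. For every $\mathcal S^\lambda$-module $M$ the $L$-module $\mathbf I(M)$ lies in $\mathcal I^\lambda$, so that $\mathbf I\colon\mathcal S^\lambda\text{-}\mathrm{Mod}\to\mathcal I^\lambda$ is a functor. 2. The maps $\xi_M\colon M\to\mathbf I(M)_\lambda$, $m\mapsto[1\otimes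 m]$, form an isomorphism of functors $\mathrm{Id}_{\mathcal S^\lambda\text{-}\mathrm{Mod}}\cong\mathbf R\circ\mathbf I$. 3. The maps $\eta_V\colon\mathbf I(V_\lambda)\to V$, $[u\otimes v]\mapsto uv$, are well-defined $L$-module maps with image $U(L)V_\lambda$, and they form a natural transformation $\eta\colon\mathbf I\circ\mathbf R\Rightarrow\mathrm{Id}_{\mathcal I^\lambda}$. 4. $\mathbf R$ is right adjoint to $\mathbf I$, with unit $\xi$ and counit $\eta$. 5. $\mathbf I$ maps projective objects to projective objects. 6. $\mathbf I$ maps cyclic modules to cyclic $L$-modules and surjective homomorphisms to surjective homomorphisms. -/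

import Mathlib

open CategoryTheory Module
open scoped TensorProduct

universe u

/-! ### Roots: connected components, admissible pairs, positive systems -/

section Roots

variable {ι k V W : Type*} [Field k] [AddCommGroup V] [Module k V] [AddCommGroup W] [Module k W]

/-- The connected component of the root `Θ.root i`: all roots that are linked to it by a chain of
roots in which consecutive members are not orthogonal. -/
def RootPairing.connectedComponent (Θ : RootPairing ι k V W) (i : ι) : Set V :=
  {α | ∃ j, Relation.ReflTransGen (fun a b => Θ.pairing a b ≠ 0) i j ∧ Θ.root j = α}

/-- `(Θ, Δ)` is an admissible pair. For every connected component `C` of `Θ`: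
* if `C` is reduced, then `C ⊆ Δ`;
* if `C` is not reduced, so of type `BC_n` with `C₁`, `C₂`, `C₄` the roots of square length
  1, 2, 4, then `Δ ∩ C` is either `C₁ ∪ C₂` (type `B_n`) or `C₂ ∪ C₄` (type `C_n`).
In type `BC_n` the set `C₄` consists of the doubles of roots, and `C₁` of the halves of roots, so
`C₁ ∪ C₂` is the set of roots that are not the double of a root, and `C₂ ∪ C₄` is the set of roots
whose double is not a root. -/
def IsAdmissiblePair (Θ : RootPairing ι k V W) (Δ : Set V) : Prop :=
  Δ ⊆ Set.range Θ.root ∧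
  ∀ i : ι,
    ((∀ α ∈ Θ.connectedComponent i, (2 : k) • α ∉ Set.range Θ.root) →
      Θ.connectedComponent i ⊆ Δ) ∧
    ((∃ α ∈ Θ.connectedComponent i, (2 : k) • α ∈ Set.range Θ.root) →
      Δ ∩ Θ.connectedComponent i =
          {α ∈ Θ.connectedComponent i | ¬ ∃ β ∈ Set.range Θ.root, α = (2 : k) • β} ∨
      Δ ∩ Θ.connectedComponent i =
          {α ∈ Θ.connectedComponent i | (2 : k) • α ∉ Set.range Θ.root})

/-- `Φpos` is a positive system of the set of roots `Φ`. -/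
structure IsPositiveSystem (Φ Φpos : Set V) : Prop where
  add_mem : ∀ α ∈ Φpos, ∀ β ∈ Φpos, α + β ∈ Φ → α + β ∈ Φpos
  neg_notMem : ∀ α ∈ Φpos, -α ∉ Φpos
  eq_union : Φ = Φpos ∪ {α | -α ∈ Φpos}

end Roots

/-! ### Root-graded Lie algebras -/

/-- The weight space `L_α = {l ∈ L | [h, l] = α(h) l for all h ∈ 𝔥}` for a subalgebra `𝔥` of a
subalgebra `𝔤` of `L` and `α ∈ 𝔥*`. -/
def adWeightSpace {k L : Type*} [Field k] [LieRing L] [LieAlgebra k L] {g : LieSubalgebra k L}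
    (H : LieSubalgebra k g) (α : Dual k H) : Submodule k L where
  carrier := {l | ∀ h : H, ⁅((h : g) : L), l⁆ = α h • l}
  zero_mem' := by simp
  add_mem' := by
    intro a b ha hb h
    rw [lie_add, ha h, hb h, smul_add]
  smul_mem' := by
    intro c a ha h
    rw [lie_smul, ha h, smul_comm]

/-- A `(Θ, Δ)`-graded Lie algebra `(L, 𝔤)` over a field of characteristic zero, together with the
usual auxiliary choices: a splitting Cartan subalgebra `𝔥` of the split semisimple subalgebra `𝔤`,
a root basis `Π = {α_i | i ∈ I}` of the root system `Δ` of `(𝔤, 𝔥)`, root vectors `e_i`, `f_i`, and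
a positive system `Θ₊` of `Θ` with `Θ₊ ∩ Δ = Δ₊`. The root system `Θ`, not necessarily
reduced or irreducible, is realised inside `𝔥*`, and `I` is `base.support`. -/
structure RootGradedLieAlgebra (k L : Type u) [Field k] [CharZero k] [LieRing L]
    [LieAlgebra k L] where
  /-- the grading subalgebra `𝔤` -/
  g : LieSubalgebra k L
  [finiteDimensional : FiniteDimensional k g]
  [isSemisimple : LieAlgebra.IsSemisimple k g]
  /-- the splitting Cartan subalgebra `𝔥` of `𝔤` -/
  H : LieSubalgebra k g
  [isCartan : H.IsCartanSubalgebra]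
  [isSplit : LieModule.IsTriangularizable k H g]
  /-- the index set of the roots in `Θ` -/
  ι : Type u
  [finite_ι : Finite ι]
  /-- the finite root system `Θ ⊆ 𝔥*` -/
  Θ : RootPairing ι k (Dual k H) H
  /-- the pairing of `𝔥*` with `𝔥` is the evaluation -/
  Θ_pairing : Θ.toLinearMap = LinearMap.id
  [Θ_isRootSystem : Θ.IsRootSystem]
  [Θ_isCrystallographic : Θ.IsCrystallographic]
  admissible : IsAdmissiblePair Θ (Set.range (LieAlgebra.IsKilling.rootSystem H).root)
  /-- `L = ∑_{α ∈ Θ ∪ {0}} L_α` -/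
  iSup_eq_top : (⨆ α ∈ Set.range Θ.root ∪ {0}, adWeightSpace H α) = ⊤
  /-- `L_0 = ∑_{α ∈ Θ} [L_α, L_{-α}]` -/
  zero_eq : adWeightSpace H 0 = Submodule.span k
    {l | ∃ i, ∃ x ∈ adWeightSpace H (Θ.root i), ∃ y ∈ adWeightSpace H (-Θ.root i), l = ⁅x, y⁆}
  /-- the root basis `Π` of `Δ` -/
  base : (LieAlgebra.IsKilling.rootSystem H).Base
  /-- the root vectors `e_i ∈ 𝔤_{α_i}` -/
  e : base.support → g
  /-- the root vectors `f_i ∈ 𝔤_{-α_i}` -/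
  f : base.support → g
  e_mem : ∀ i, (e i : L) ∈ adWeightSpace H ((LieAlgebra.IsKilling.rootSystem H).root i.1)
  f_mem : ∀ i, (f i : L) ∈ adWeightSpace H (-(LieAlgebra.IsKilling.rootSystem H).root i.1)
  /-- `[e_i, f_i] = h_i`, where `h_i` is the coroot of `α_i` -/
  lie_e_f : ∀ i, ⁅e i, f i⁆ = ((LieAlgebra.IsKilling.rootSystem H).coroot i.1 : g)
  /-- the positive system `Θ₊` of `Θ` -/
  Θpos : Set (Dual k H)
  isPositiveSystem : IsPositiveSystem (Set.range Θ.root) Θpos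
  /-- `Θ₊ ∩ Δ = Δ₊` -/
  Θpos_inter : Θpos ∩ Set.range (LieAlgebra.IsKilling.rootSystem H).root =
    {α ∈ Set.range (LieAlgebra.IsKilling.rootSystem H).root |
      α ∈ AddSubmonoid.closure ((LieAlgebra.IsKilling.rootSystem H).root '' base.support)}

attribute [instance] RootGradedLieAlgebra.finiteDimensional RootGradedLieAlgebra.isSemisimple
  RootGradedLieAlgebra.isCartan RootGradedLieAlgebra.isSplit RootGradedLieAlgebra.finite_ι
  RootGradedLieAlgebra.Θ_isRootSystem RootGradedLieAlgebra.Θ_isCrystallographic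

namespace RootGradedLieAlgebra

attribute [local instance] LieRing.ofAssociativeRing

variable {k L : Type u} [Field k] [CharZero k] [LieRing L] [LieAlgebra k L]
variable (D : RootGradedLieAlgebra k L)

/-- The universal enveloping algebra `U(L)`. An `L`-module is the same as a left `U(L)`-module. -/
abbrev U (_D : RootGradedLieAlgebra k L) : Type u := UniversalEnvelopingAlgebra k L

/-- The canonical map `L → U(L)`. -/
noncomputable abbrev incl : L → D.U := UniversalEnvelopingAlgebra.ι k

/-- The simple root `α_i`. -/
noncomputable def simpleRoot (i : D.base.support) : Dual k D.H :=
  (LieAlgebra.IsKilling.rootSystem D.H).root i.1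

/-- The simple coroot `h_i`. -/
noncomputable def simpleCoroot (i : D.base.support) : D.H :=
  (LieAlgebra.IsKilling.rootSystem D.H).coroot i.1

/-- A dominant integral weight `λ = ∑_i ℓ_i ϖ_i ∈ P₊`, i.e. `λ(h_i) = ℓ_i ∈ ℕ` for all `i ∈ I`. -/
structure DominantWeight where
  /-- the weight `λ ∈ 𝔥*` -/
  wt : Dual k D.H
  /-- the coefficients `ℓ_i` -/
  ell : D.base.support → ℕ
  apply_simpleCoroot : ∀ i, wt (D.simpleCoroot i) = ell i

/-- The weight space `L_α`. -/
def rootSpace (α : Dual k D.H) : Submodule k L := adWeightSpace D.H α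

/-- The Lie subalgebra `L_0`, the weight space of weight `0`. -/
def L0 : LieSubalgebra k L :=
  { D.rootSpace 0 with
    lie_mem' := by
      intro x y hx hy h
      have hx' : ⁅((h : D.g) : L), x⁆ = 0 := by simpa using hx h
      have hy' : ⁅((h : D.g) : L), y⁆ = 0 := by simpa using hy h
      change ⁅((h : D.g) : L), ⁅x, y⁆⁆ = (0 : Dual k D.H) h • ⁅x, y⁆
      rw [leibniz_lie, hx', hy']
      simp }

/-- The universal enveloping algebra `U(L_0)`. -/
abbrev U0 : Type u := UniversalEnvelopingAlgebra k D.L0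

/-- The canonical homomorphism `U(L_0) → U(L)` induced by the inclusion `L_0 → L`. -/
noncomputable def U0ToU : D.U0 →ₐ[k] D.U :=
  UniversalEnvelopingAlgebra.lift k ((UniversalEnvelopingAlgebra.ι k).comp D.L0.incl)

/-- `L_+ = ⨁_{α ∈ Θ₊} L_α`. -/
def Lpos : Submodule k L := ⨆ α ∈ D.Θpos, D.rootSpace α

/-- The left ideal `U(L) L_+` of `U(L)`. -/
noncomputable def leftIdealLpos : Submodule D.U D.U :=
  Submodule.span D.U (D.incl '' (D.Lpos : Set L))

/-- `U(L)_0`, the elements of `U(L)` of weight `0` with respect to `𝔥`. -/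
def UZero : Set D.U := {a | ∀ h : D.H, D.incl ((h : D.g) : L) * a = a * D.incl ((h : D.g) : L)}

/-- The graph of the Harish-Chandra homomorphism
`π_0 : U(L)_0 = U(L_0) ⊕ K → U(L_0)`, the projection with kernel `K = U(L) L_+ ∩ U(L)_0`:
`π_0(a) = z` means that `a ∈ U(L)_0`, `z ∈ U(L_0)` and `a - z ∈ K`. -/
def IsHarishChandra (a : D.U) (z : D.U0) : Prop :=
  a ∈ D.UZero ∧ a - D.U0ToU z ∈ (D.leftIdealLpos : Set D.U) ∩ D.UZero

/-- `N[Θ₊]`, the additive submonoid of `𝔥*` spanned by `Θ₊`. -/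
def posCone : AddSubmonoid (Dual k D.H) := AddSubmonoid.closure D.Θpos

lemma coe_H_mem_L0 (h : D.H) : ((h : D.g) : L) ∈ D.L0 := by
  intro h'
  have : ⁅h', h⁆ = 0 := trivial_lie_zero _ _ _ _
  have h2 : ⁅((h' : D.g) : L), ((h : D.g) : L)⁆ = 0 := by
    have := congrArg (fun x : D.H => ((x : D.g) : L)) this
    simpa using this
  simp [h2]

/-- The inclusion `𝔥 → L_0`. -/
def cartanToL0 (h : D.H) : D.L0 := ⟨((h : D.g) : L), D.coe_H_mem_L0 h⟩

variable {D}

/-! ### The Seligman algebra -/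

/-- The generators of the ideal `J^λ` of `U(L_0)`, for `λ = ∑ ℓ_i ϖ_i`:
(i) the elements `π_0(x_1 ⋯ x_m y_1 ⋯ y_{ℓ_i + 1})` with `x_j ∈ L_{β_j}`, `β_j ∈ Θ₊`,
`∑ β_j = (ℓ_i + 1) α_i` and `y_j ∈ L_{-α_i}`; (ii) the elements `h_i - ℓ_i`. -/
def seligmanGenerators (lam : D.DominantWeight) : Set D.U0 :=
  {z | ∃ (i : D.base.support) (m : ℕ) (β : Fin m → Dual k D.H) (x : Fin m → L)
      (y : Fin (lam.ell i + 1) → L),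
      (∀ j, β j ∈ D.Θpos) ∧ (∀ j, x j ∈ D.rootSpace (β j)) ∧
      (∑ j, β j = (lam.ell i + 1) • D.simpleRoot i) ∧
      (∀ j, y j ∈ D.rootSpace (-D.simpleRoot i)) ∧
      D.IsHarishChandra ((List.ofFn fun j => D.incl (x j)).prod *
        (List.ofFn fun j => D.incl (y j)).prod) z} ∪
  {z | ∃ i : D.base.support,
      z = UniversalEnvelopingAlgebra.ι k (D.cartanToL0 (D.simpleCoroot i)) - (lam.ell i : D.U0)}

/-- The two-sided ideal `J^λ` of `U(L_0)`. -/
def seligmanIdeal (lam : D.DominantWeight) : Ideal D.U0 :=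
  (TwoSidedIdeal.span (seligmanGenerators lam)).asIdeal

instance (lam : D.DominantWeight) : (seligmanIdeal lam).IsTwoSided :=
  inferInstanceAs (TwoSidedIdeal.asIdeal _).IsTwoSided

/-- The Seligman algebra `S^λ = U(L_0) / J^λ`. -/
abbrev Seligman (lam : D.DominantWeight) : Type u := D.U0 ⧸ seligmanIdeal lam

/-! ### Integrable modules and the restriction functor -/

section WeightSpace

variable (D)
variable (V : Type u) [AddCommGroup V] [Module D.U V]

/-- The weight space `V_μ = {v ∈ V | h v = μ(h) v for all h ∈ 𝔥}` of an `L`-module `V`. -/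
def weightSpace (μ : Dual k D.H) : AddSubgroup V where
  carrier := {v | ∀ h : D.H, D.incl ((h : D.g) : L) • v = algebraMap k D.U (μ h) • v}
  zero_mem' := by simp
  add_mem' := by
    intro a b ha hb h
    rw [smul_add, smul_add, ha h, hb h]
  neg_mem' := by
    intro a ha h
    rw [smul_neg, smul_neg, ha h]

lemma U0ToU_mem_UZero (a : D.U0) : D.U0ToU a ∈ D.UZero := by
  intro h
  let C : Subalgebra k D.U := Subalgebra.centralizer k {D.incl ((h : D.g) : L)}
  let C' : Subalgebra k D.U0 := C.comap D.U0ToU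
  have hx : ∀ x : D.L0, UniversalEnvelopingAlgebra.ι k x ∈ C' := by
    intro x
    change D.U0ToU _ ∈ C
    rw [U0ToU, UniversalEnvelopingAlgebra.lift_ι_apply]
    rw [Subalgebra.mem_centralizer_iff]
    intro y hy
    rw [Set.mem_singleton_iff.1 hy]
    have h0 : ⁅((h : D.g) : L), (x : L)⁆ = 0 := by simpa using x.2 h
    have h1 := (UniversalEnvelopingAlgebra.ι k).map_lie ((h : D.g) : L) (x : L)
    rw [h0, _root_.map_zero, LieRing.of_associative_ring_bracket] at h1
    exact (sub_eq_zero.1 h1.symm)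
  let s : D.L0 →ₗ⁅k⁆ C' :=
    { toFun := fun x => ⟨UniversalEnvelopingAlgebra.ι k x, hx x⟩
      map_add' := by intro x y; ext; simp
      map_smul' := by intro c x; ext; simp
      map_lie' := by
        intro x y
        ext
        simp [LieRing.of_associative_ring_bracket] }
  have hid : C'.val.comp (UniversalEnvelopingAlgebra.lift k s) = AlgHom.id k D.U0 := by
    apply UniversalEnvelopingAlgebra.hom_ext
    ext x
    change C'.val (UniversalEnvelopingAlgebra.lift k s (UniversalEnvelopingAlgebra.ι k x)) = _
    rw [UniversalEnvelopingAlgebra.lift_ι_apply]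
    rfl
  have ha : a ∈ C' := by
    have := (UniversalEnvelopingAlgebra.lift k s a).2
    have h2 := congrArg (fun F : D.U0 →ₐ[k] D.U0 => F a) hid
    change ((UniversalEnvelopingAlgebra.lift k s a : C') : D.U0) = a at h2
    rwa [h2] at this
  have ha' : D.U0ToU a ∈ C := ha
  exact (Subalgebra.mem_centralizer_iff k).1 ha' _ rfl

variable {V} in
lemma U0ToU_smul_mem {μ : Dual k D.H} (a : D.U0) {v : V} (hv : v ∈ D.weightSpace V μ) :
    D.U0ToU a • v ∈ D.weightSpace V μ := by
  intro h
  rw [← mul_smul, D.U0ToU_mem_UZero a h, mul_smul, hv h, ← mul_smul, ← mul_smul,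
    Algebra.commutes]

/-- Every weight space of an `L`-module is an `L_0`-module. -/
noncomputable instance (μ : Dual k D.H) : Module D.U0 (D.weightSpace V μ) where
  smul a v := ⟨D.U0ToU a • (v : V), D.U0ToU_smul_mem a v.2⟩
  one_smul v := Subtype.ext (show D.U0ToU 1 • (v : V) = v by rw [map_one, one_smul])
  mul_smul a b v := Subtype.ext
    (show D.U0ToU (a * b) • (v : V) = D.U0ToU a • D.U0ToU b • (v : V) by rw [map_mul, mul_smul])
  smul_zero a := Subtype.ext (show D.U0ToU a • (0 : V) = 0 by rw [smul_zero])
  smul_add a v w := Subtype.ext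
    (show D.U0ToU a • ((v : V) + w) = D.U0ToU a • (v : V) + D.U0ToU a • (w : V) by rw [smul_add])
  add_smul a b v := Subtype.ext
    (show D.U0ToU (a + b) • (v : V) = D.U0ToU a • (v : V) + D.U0ToU b • (v : V) by
      rw [map_add, add_smul])
  zero_smul v := Subtype.ext (show D.U0ToU 0 • (v : V) = 0 by rw [map_zero, zero_smul])

/-- `V` is integrable as a `𝔤`-module: all `e_i` and `f_i` act locally nilpotently. -/
def IsIntegrable : Prop :=
  ∀ (i : D.base.support) (v : V),
    (∃ n : ℕ, D.incl (D.e i : L) ^ n • v = 0) ∧ (∃ n : ℕ, D.incl (D.f i : L) ^ n • v = 0)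

end WeightSpace

/-- The objects of the category `I^λ = I(L, 𝔤)^λ`: the `L`-modules `V` that are integrable as
`𝔤`-modules and all of whose weights lie in `λ - N[Θ₊]`. -/
def isIntegrableBounded (lam : D.DominantWeight) : ObjectProperty (ModuleCat.{u} D.U) :=
  fun V => D.IsIntegrable V ∧
    ∀ μ : Dual k D.H, D.weightSpace V μ ≠ ⊥ → lam.wt - μ ∈ D.posCone

/-- The category `I^λ = I(L, 𝔤)^λ`, a full subcategory of the category of `L`-modules. -/
abbrev IntCat (lam : D.DominantWeight) := (isIntegrableBounded lam).FullSubcategory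

/-- `J^λ` annihilates `V_λ` for every `V` in `I^λ`, so that `V_λ` is an `S^λ`-module. -/
def RestrictionWellDefined (lam : D.DominantWeight) : Prop :=
  ∀ V : ModuleCat.{u} D.U, isIntegrableBounded lam V →
    Module.IsTorsionBySet D.U0 (D.weightSpace V lam.wt) (seligmanIdeal lam)

/-- The restriction functor `R : I^λ ⥤ S^λ-Mod`, `V ↦ V_λ`, where the class of `a ∈ U(L_0)` acts
on `V_λ` as `a`, and a morphism is restricted to the weight spaces. -/
noncomputable def restriction (lam : D.DominantWeight) (hR : RestrictionWellDefined lam) :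
    IntCat lam ⥤ ModuleCat.{u} (Seligman lam) where
  obj V := @ModuleCat.of (Seligman lam) _ (D.weightSpace V.obj lam.wt) _ (hR V.obj V.property).module
  map {V W} φ :=
    letI := (hR V.obj V.property).module
    letI := (hR W.obj W.property).module
    ModuleCat.ofHom
      { toFun := fun v => ⟨φ.hom.hom (v : V.obj), by
          intro h
          rw [← map_smul, v.2 h, map_smul]⟩
        map_add' := fun v w => Subtype.ext (map_add φ.hom.hom (v : V.obj) (w : V.obj))
        map_smul' := by
          intro s v
          obtain ⟨a, rfl⟩ := Ideal.Quotient.mk_surjective s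
          exact Subtype.ext (map_smul φ.hom.hom (D.U0ToU a) (v : V.obj)) }
  map_id V := rfl
  map_comp φ ψ := rfl

/-- The inclusion of `R(V) = V_λ` into `V`. -/
def restrictionIncl (lam : D.DominantWeight) (hR : RestrictionWellDefined lam) (V : IntCat lam)
    (v : (restriction lam hR).obj V) : V.obj :=
  Subtype.val (p := fun w : V.obj => w ∈ D.weightSpace V.obj lam.wt) v

/-! ### The integrable induction functor -/

section Induction

variable (lam : D.DominantWeight) (M : Type u) [AddCommGroup M] [Module (Seligman lam) M]

/-- The relations that define `U(L) ⊗_{U(L_0 ⊕ L_+)} M` as a quotient of `U(L) ⊗_ℤ M`. Here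
`L_0` acts on the `S^λ`-module `M` through `U(L_0) → S^λ`, and `L_+` acts on `M` by `0`.
Since the algebra `U(L_0 ⊕ L_+)` is generated by `U(L_0)` and `L_+`, it suffices to balance the
tensor product over these. -/
noncomputable def balancing : Submodule D.U (D.U ⊗[ℤ] M) :=
  Submodule.span D.U
    ({t | ∃ (a : D.U) (b : D.U0) (m : M),
        t = (a * D.U0ToU b) ⊗ₜ[ℤ] m - a ⊗ₜ[ℤ] ((Ideal.Quotient.mk (seligmanIdeal lam) b) • m)} ∪
      {t | ∃ (a : D.U) (x : L) (m : M), x ∈ D.Lpos ∧ t = (a * D.incl x) ⊗ₜ[ℤ] m})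

/-- The induced `L`-module `M̃ = U(L) ⊗_{U(L_0 ⊕ L_+)} M`. -/
abbrev Induced : Type u := (D.U ⊗[ℤ] M) ⧸ balancing lam M

/-- The submodule `Ñ = ∑_i ∑_m U(L) (f_i^{ℓ_i + 1} ⊗ m)` of `M̃`. -/
noncomputable def inducedRel : Submodule D.U (Induced lam M) :=
  ⨆ (i : D.base.support) (m : M), Submodule.span D.U
    {(balancing lam M).mkQ ((D.incl (D.f i : L) ^ (lam.ell i + 1)) ⊗ₜ[ℤ] m)}

/-- The `L`-module `I(M) = M̃ / Ñ`. -/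
abbrev IntInduced : Type u := Induced lam M ⧸ inducedRel lam M

variable {M}

/-- The class of `a ⊗ m` in `I(M)`, for `a ∈ U(L)` and `m ∈ M`. -/
noncomputable def intMk (a : D.U) (m : M) : IntInduced lam M :=
  (inducedRel lam M).mkQ ((balancing lam M).mkQ (a ⊗ₜ[ℤ] m))

variable {N : Type u} [AddCommGroup N] [Module (Seligman lam) N]

/-- The map `Id ⊗ f` from `U(L) ⊗_ℤ M` to `U(L) ⊗_ℤ N`. -/
noncomputable def tensorMap (f : M →ₗ[Seligman lam] N) : D.U ⊗[ℤ] M →ₗ[D.U] D.U ⊗[ℤ] N :=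
  TensorProduct.AlgebraTensorModule.map LinearMap.id (f.toAddMonoidHom.toIntLinearMap)

lemma balancing_le (f : M →ₗ[Seligman lam] N) :
    balancing lam M ≤ (balancing lam N).comap (tensorMap lam f) := by
  refine Submodule.span_le.2 ?_
  rintro t (⟨a, b, m, rfl⟩ | ⟨a, x, m, hx, rfl⟩)
  · refine Submodule.subset_span (Or.inl ⟨a, b, f m, ?_⟩)
    rw [map_sub]
    simp [tensorMap]
  · exact Submodule.subset_span (Or.inr ⟨a, x, f m, hx, by simp [tensorMap]⟩)

/-- The map `Id ⊗ f` between the induced modules of `M` and `N`. -/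
noncomputable def inducedMap (f : M →ₗ[Seligman lam] N) : Induced lam M →ₗ[D.U] Induced lam N :=
  Submodule.mapQ _ _ (tensorMap lam f) (balancing_le lam f)

lemma inducedRel_le (f : M →ₗ[Seligman lam] N) :
    inducedRel lam M ≤ (inducedRel lam N).comap (inducedMap lam f) := by
  refine iSup_le fun i => iSup_le fun m => Submodule.span_le.2 ?_
  rintro t rfl
  refine Submodule.mem_iSup_of_mem i (Submodule.mem_iSup_of_mem (f m) ?_)
  refine Submodule.subset_span ?_
  simp [inducedMap, tensorMap]

/-- The map `I(f) : I(M) → I(N)` induced by `Id ⊗ f`. -/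
noncomputable def intInducedMap (f : M →ₗ[Seligman lam] N) :
    IntInduced lam M →ₗ[D.U] IntInduced lam N :=
  Submodule.mapQ _ _ (inducedMap lam f) (inducedRel_le lam f)

lemma intInducedMap_intMk (f : M →ₗ[Seligman lam] N) (a : D.U) (m : M) :
    intInducedMap lam f (intMk lam a m) = intMk lam a (f m) := by
  simp [intInducedMap, intMk, inducedMap, tensorMap]

lemma intInduced_hom_ext {V : Type u} [AddCommGroup V] [Module D.U V]
    {φ ψ : IntInduced lam M →ₗ[D.U] V}
    (h : ∀ a m, φ (intMk lam a m) = ψ (intMk lam a m)) : φ = ψ := by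
  refine LinearMap.ext fun t => ?_
  obtain ⟨t, rfl⟩ := Submodule.mkQ_surjective _ t
  obtain ⟨t, rfl⟩ := Submodule.mkQ_surjective _ t
  induction t using TensorProduct.induction_on with
  | zero => simp
  | tmul a m => exact h a m
  | add x y hx hy => rw [map_add, map_add, map_add, map_add, hx, hy]

end Induction

/-- `I(M)` is an object of `I^λ` for every `S^λ`-module `M`. -/
def InductionWellDefined (lam : D.DominantWeight) : Prop :=
  ∀ M : ModuleCat.{u} (Seligman lam),
    isIntegrableBounded lam (ModuleCat.of D.U (IntInduced lam M))

/-- The integrable induction functor `I : S^λ-Mod ⥤ I^λ`, `M ↦ I(M)`, `f ↦ I(f)`. -/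
noncomputable def induction (lam : D.DominantWeight) (hI : InductionWellDefined lam) :
    ModuleCat.{u} (Seligman lam) ⥤ IntCat lam where
  obj M := ⟨ModuleCat.of D.U (IntInduced lam M), hI M⟩
  map f := ObjectProperty.homMk (ModuleCat.ofHom (intInducedMap lam f.hom))
  map_id M := by
    refine ObjectProperty.hom_ext _ (ModuleCat.hom_ext (intInduced_hom_ext lam fun a m => ?_))
    exact intInducedMap_intMk lam _ a m
  map_comp f g := by
    refine ObjectProperty.hom_ext _ (ModuleCat.hom_ext (intInduced_hom_ext lam fun a m => ?_))
    change intInducedMap lam _ (intMk lam a m) =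
      intInducedMap lam g.hom (intInducedMap lam f.hom (intMk lam a m))
    rw [intInducedMap_intMk, intInducedMap_intMk, intInducedMap_intMk]
    rfl

end RootGradedLieAlgebra

open RootGradedLieAlgebra

/-! Everything rests on three facts: the cone `ℕ[Θ₊]` is pointed, `U(L)` is spanned by products of
words in `L_-`, elements of `U(L_0)` and words in `L_+`, and integrable `L`-modules are sums of
their weight spaces.

`R` is well defined: for `V` in `I^λ` pointedness gives `L_+ V_λ = 0`, and `sl₂`-theory shows that
`λ - (ℓ_i + 1) α_i` is not a weight, because `e_i ^ (ℓ_i + 2)` would carry it injectively to `λ +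
α_i`. So `y_1 ⋯ y_{ℓ_i + 1}` kills `V_λ`, and so does `π_0(x_1 ⋯ x_m y_1 ⋯ y_{ℓ_i + 1})`
(`IsBounded.isTorsionBySet`). `I` is well defined: `I(M)` is generated by vectors on which each
`e_i` and `f_i` is nilpotent, root vectors are ad-nilpotent on `L` because `Θ` is finite, and words
in `L_-` applied to `1 ⊗ M` span.

`ξ_M` is onto because a word of degree zero is empty. For injectivity (`intMk_injective`) a map
`proj : U(L) → S^λ` is built: project to weight zero, apply `π_0`, reduce modulo `J^λ`. It kills
`U(L) f_i ^ (ℓ_i + 1)` (`proj_mul_f_pow`), which is what the generators of `J^λ` are designed for,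
so `a ⊗ m ↦ proj(a) m` vanishes on all relations of `I(M)` and sends `1 ⊗ m` to `m`. No PBW theorem
is needed: an element of `U(L_0)` whose image lies in `U(L) L_+` is already in `J^λ`
(`mem_seligmanIdeal_of_mem_leftIdealLpos`).

The counit comes from the universal property `intLift`, and the triangle identities are checked on
generators. `I` preserves projectives since its right adjoint `R` preserves epimorphisms: cokernels
stay in `I^λ`, so epimorphisms are surjective, and surjections of weight modules are surjective on
weight spaces. That integrable modules are weight modules is `SlTwoAction.iSup_eigenspace_eq_top`,
proved without finite-dimensionality. -/

/-! ### Simultaneous eigenvectors -/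

section JointEigenvectors

variable {k V H X : Type*} [Field k] [AddCommGroup V] [Module k V]

/-- Elimination of one summand at a time: an operator `φ h - wt a h` kills the summand of index `a`,
preserves `P`, and scales the summand of index `χ` by a nonzero factor once `h` separates `χ` from
`a`. -/
lemma Submodule.mem_of_sum_eigenvectors_mem (φ : H → End k V) {wt : X → H → k}
    (hwt : Function.Injective wt) {P : Submodule k V} (hP : ∀ h, ∀ v ∈ P, φ h v ∈ P)
    (s : Finset X) : ∀ y : X → V, (∀ χ ∈ s, ∀ h, φ h (y χ) = wt χ h • y χ) →
      ∑ χ ∈ s, y χ ∈ P → ∀ χ ∈ s, y χ ∈ P := by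
  classical
  induction s using Finset.induction_on with
  | empty => simp
  | insert a s ha ih =>
    intro y hy hsum
    have key : ∀ χ ∈ s, y χ ∈ P := by
      intro χ hχ
      have hne : wt χ ≠ wt a := fun h => ha (hwt h ▸ hχ)
      obtain ⟨h, hh⟩ := Function.ne_iff.1 hne
      have h1 : ∑ ψ ∈ s, (wt ψ h - wt a h) • y ψ ∈ P := by
        have h2 := P.sub_mem (hP h _ hsum) (P.smul_mem (wt a h) hsum)
        rw [Finset.sum_insert ha, map_add, map_sum, hy a (Finset.mem_insert_self _ _),
          smul_add, add_sub_add_left_eq_sub, Finset.smul_sum, ← Finset.sum_sub_distrib] at h2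
        convert h2 using 1
        refine Finset.sum_congr rfl fun ψ hψ => ?_
        rw [hy ψ (Finset.mem_insert_of_mem hψ), sub_smul]
      have h3 := ih (fun ψ => (wt ψ h - wt a h) • y ψ) (fun ψ hψ h' => by
        rw [map_smul, hy ψ (Finset.mem_insert_of_mem hψ), smul_comm]) h1 χ hχ
      exact (P.smul_mem_iff (sub_ne_zero.2 hh)).1 h3
    intro χ hχ
    rcases Finset.mem_insert.1 hχ with rfl | hχ
    · rw [Finset.sum_insert ha] at hsum
      exact (P.add_mem_iff_left (P.sum_mem key)).1 hsum
    · exact key χ hχ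

lemma Submodule.mem_iSup_inf_of_eigenvectors (φ : H → End k V) {wt : X → H → k}
    (hwt : Function.Injective wt) {P : Submodule k V} (hP : ∀ h, ∀ v ∈ P, φ h v ∈ P)
    (A : X → Submodule k V) (hA : ∀ χ, ∀ v ∈ A χ, ∀ h, φ h v = wt χ h • v) {z : V}
    (hz : z ∈ ⨆ χ, A χ) (hzP : z ∈ P) : z ∈ ⨆ χ, A χ ⊓ P := by
  obtain ⟨y, hy, rfl⟩ := (Submodule.mem_iSup_iff_exists_finsupp _ _).1 hz
  have := Submodule.mem_of_sum_eigenvectors_mem φ hwt hP y.support y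
    (fun χ _ => hA χ _ (hy χ)) hzP
  exact Submodule.sum_mem _ fun χ hχ => Submodule.mem_iSup_of_mem χ ⟨hy χ, this χ hχ⟩

/-- Independence of joint eigenspaces, i.e. the case `P = ⊥` of the elimination. The `A χ` may be
smaller than the full eigenspaces, so this also identifies the homogeneous part of a graded
subspace. -/
lemma Submodule.mem_of_mem_iSup_of_eigenvector (φ : H → End k V) {wt : X → H → k}
    (hwt : Function.Injective wt)
    (A : X → Submodule k V) (hA : ∀ χ, ∀ v ∈ A χ, ∀ h, φ h v = wt χ h • v) {z : V} {μ : X}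
    (hz : z ∈ ⨆ χ, A χ) (hzμ : ∀ h, φ h z = wt μ h • z) : z ∈ A μ := by
  classical
  obtain ⟨y, hy, rfl⟩ := (Submodule.mem_iSup_iff_exists_finsupp _ _).1 hz
  set z := y.sum fun _ v => v with hz'
  have h0 : ∑ χ ∈ insert μ y.support, (y χ - if χ = μ then z else 0) ∈ (⊥ : Submodule k V) := by
    rw [Finset.sum_sub_distrib, Finset.sum_ite_eq', if_pos (Finset.mem_insert_self _ _),
      Submodule.mem_bot, sub_eq_zero, hz', Finsupp.sum,
      Finset.sum_insert_of_eq_zero_if_notMem fun h => Finsupp.notMem_support_iff.1 h]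
  have := Submodule.mem_of_sum_eigenvectors_mem φ hwt (P := ⊥) (by simp) _
    (fun χ => y χ - if χ = μ then z else 0) (fun χ _ h => by
      split_ifs with hχ
      · rw [map_sub, hA χ _ (hy χ), hzμ, hχ, smul_sub]
      · rw [sub_zero, hA χ _ (hy χ)]) h0 μ (Finset.mem_insert_self _ _)
  rw [if_pos rfl, Submodule.mem_bot, sub_eq_zero] at this
  exact this ▸ hy μ

end JointEigenvectors

/-! ### Integrable representations of `sl₂` -/

section SlTwo

variable {k V : Type*} [Field k] [AddCommGroup V] [Module k V]

/-- A representation of `sl₂` on `V`. -/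
structure SlTwoAction (e f h : End k V) : Prop where
  e_f : ∀ v, e (f v) = f (e v) + h v
  h_e : ∀ v, h (e v) = e (h v) + (2 : k) • e v
  h_f : ∀ v, h (f v) = f (h v) - (2 : k) • f v

namespace SlTwoAction

variable {e f h : End k V} (S : SlTwoAction e f h)
include S

lemma h_f_pow (n : ℕ) (v : V) :
    h ((f ^ n) v) = (f ^ n) (h v) - (2 * n : k) • (f ^ n) v := by
  induction n generalizing v with
  | zero => simp
  | succ n ih =>
    rw [pow_succ, End.mul_apply, End.mul_apply, ih, S.h_f, map_sub, map_smul, Nat.cast_succ]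
    module

lemma e_f_pow (n : ℕ) (v : V) :
    e ((f ^ (n + 1)) v) = (f ^ (n + 1)) (e v) + (n + 1 : k) • (f ^ n) (h v - (n : k) • v) := by
  induction n generalizing v with
  | zero => simp [S.e_f]
  | succ n ih =>
    rw [pow_succ, End.mul_apply, ih, S.e_f, S.h_f, End.mul_apply,
      map_add, pow_succ f n]
    simp only [End.mul_apply, map_sub, map_smul, Nat.cast_succ]
    module

lemma f_e_pow (n : ℕ) (v : V) :
    f ((e ^ (n + 1)) v) = (e ^ (n + 1)) (f v) - (n + 1 : k) • (e ^ n) (h v + (n : k) • v) := by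
  induction n generalizing v with
  | zero => simp [S.e_f]
  | succ n ih =>
    have h1 : f (e v) = e (f v) - h v := by rw [S.e_f]; abel
    rw [pow_succ, End.mul_apply, ih, h1, S.h_e, End.mul_apply,
      map_sub, pow_succ e n]
    simp only [End.mul_apply, map_add, map_smul, Nat.cast_succ]
    module

variable [CharZero k]

/-- If `f` is locally nilpotent, then `e ^ n` is injective on the `h`-eigenspace of `-n`. -/
lemma eq_zero_of_e_pow_eq_zero (p : ℕ) : ∀ (n : ℕ) (w : V), h w = -(n : k) • w →
    (f ^ p) w = 0 → (e ^ n) w = 0 → w = 0 := by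
  induction p with
  | zero => intro n w _ hf _; simpa using hf
  | succ p ih =>
    intro n w hw hf he
    have hfw : f w = 0 := by
      -- The vector `f w` has `h`-eigenvalue `-(n + 2)`. All `e ^ (n + j)` kill `w`, so commuting
      -- `f` past `e ^ (n + 2)` shows that `e ^ (n + 2)` kills `f w`.
      refine ih (n + 2) (f w) ?_ (by rwa [pow_succ, End.mul_apply] at hf) ?_
      · rw [S.h_f, hw, map_smul]; push_cast; module
      · have h1 := S.f_e_pow (n + 1) w
        have h2 : ∀ j, (e ^ (n + j)) w = 0 := fun j => by
          rw [add_comm, pow_add, End.mul_apply, he, map_zero]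
        have h3 := h2 1
        rw [h2 2, map_zero, hw, map_add, map_smul, map_smul, h3] at h1
        simpa using h1.symm
    -- Now `w` is a lowest weight vector, and `f e ^ (m + 1) w = (m + 1) (n - m) e ^ m w` has
    -- nonzero coefficient for `m < n`. So vanishing descends from `e ^ n w` to `w`.
    have hj : ∀ j ≤ n, (e ^ (n - j)) w = 0 := by
      intro j
      induction j with
      | zero => intro _; simpa using he
      | succ j ihj =>
        intro hjn
        obtain ⟨m, hm⟩ := Nat.exists_eq_add_of_lt (Nat.lt_of_succ_le hjn)
        have h1 := ihj (by omega)
        rw [show n - j = m + 1 by omega] at h1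
        have h2 := S.f_e_pow m w
        rw [h1, hfw, map_zero, map_zero, hw, ← add_smul, map_smul, smul_smul, zero_sub,
          zero_eq_neg, smul_eq_zero] at h2
        rw [show n - (j + 1) = m by omega]
        refine h2.resolve_left (mul_ne_zero (Nat.cast_add_one_ne_zero m) ?_)
        rw [neg_add_eq_sub, sub_ne_zero]
        exact_mod_cast (by omega : m ≠ n)
    simpa using hj n le_rfl

/-- If `e` is locally nilpotent, then `e` maps onto the `h`-eigenspaces of positive integers. -/
lemma exists_e_eq (p : ℕ) : ∀ (j t : ℕ) (x : V), h x = (2 * j + 1 + t : k) • x →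
    (e ^ p) x = 0 → ∃ y, e y = (f ^ j) x ∧ h y = (t - 1 : k) • y := by
  induction p with
  | zero => intro j t x _ hx; exact ⟨0, by simp [show x = 0 by simpa using hx]⟩
  | succ p ih =>
    intro j t x hx he
    obtain ⟨y', hy', hhy'⟩ := ih (j + 1) t (e x)
      (by rw [S.h_e, hx, map_smul]; push_cast; module) (by rwa [pow_succ] at he)
    -- This is the coefficient of `f ^ j x` in `e (f ^ (j + 1) x)`; the other term `f ^ (j + 1) (e
    -- x)` equals `e y'`, so the difference of `f ^ (j + 1) x` and `y'` only needs rescaling.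
    have hc : ((j + 1) * (j + 1 + t) : k) ≠ 0 := by
      have : ((j + 1) * (j + 1 + t) : ℕ) ≠ 0 := by positivity
      exact_mod_cast this
    refine ⟨((j + 1) * (j + 1 + t) : k)⁻¹ • ((f ^ (j + 1)) x - y'), ?_, ?_⟩
    · rw [map_smul, map_sub, hy', S.e_f_pow, hx, add_sub_cancel_left, inv_smul_eq_iff₀ hc,
        ← sub_smul, map_smul, smul_smul]
      congr 1; ring
    · rw [map_smul, map_sub, hhy', S.h_f_pow, hx, map_smul]; push_cast; module

/-- In an integrable representation of `sl₂` the element `h` acts diagonalizably. -/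
theorem iSup_eigenspace_eq_top (he : ∀ v, ∃ n, (e ^ n) v = 0) (hf : ∀ v, ∃ n, (f ^ n) v = 0) :
    ⨆ c, h.eigenspace c = ⊤ := by
  set E : Submodule k V := ⨆ c, h.eigenspace c with hE
  have mem_E : ∀ c v, h v = c • v → v ∈ E := fun c v hv =>
    Submodule.mem_iSup_of_mem c (End.mem_eigenspace_iff.2 hv)
  have E_stable : ∀ (g : End k V) (c : k), (∀ v, h (g v) = g (h v) + c • g v) →
      ∀ v ∈ E, g v ∈ E := by
    intro g c hg v hv
    refine Submodule.iSup_induction _ (motive := fun v => g v ∈ E) hv (fun d x hx => ?_) (by simp)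
      (fun x y hx hy => by rw [map_add]; exact E.add_mem hx hy)
    rw [End.mem_eigenspace_iff] at hx
    exact mem_E (d + c) _ (by rw [hg, hx, map_smul, add_smul])
  have E_e : ∀ v ∈ E, e v ∈ E := E_stable e 2 S.h_e
  have E_f : ∀ v ∈ E, f v ∈ E :=
    E_stable f (-2) fun v => by rw [S.h_f, neg_smul, sub_eq_add_neg]
  have E_h : ∀ v ∈ E, h v ∈ E := E_stable h 0 (by simp)
  have E_pow : ∀ g : End k V, (∀ v ∈ E, g v ∈ E) → ∀ n, ∀ v ∈ E, (g ^ n) v ∈ E := by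
    intro g hg n
    induction n with
    | zero => simp
    | succ n ih => intro v hv; rw [pow_succ]; exact ih _ (hg v hv)
  have e_sub : ∀ (c : k) v, e (h v - c • v) = h (e v) - (c + 2) • e v := by
    intro c v; rw [S.h_e, map_sub, map_smul]; module
  -- the kernel of `e` is contained in `E`
  have ker_e : ∀ (n : ℕ) v, e v = 0 → (e ^ n) ((f ^ n) v) = 0 →
      v ∈ ⨆ j : Fin n, h.eigenspace (j : k) := by
    intro n
    induction n with
    | zero => intro v _ hv; simp [show v = 0 by simpa using hv]
    | succ n ih =>
      intro v hev hn
      -- As `e v = 0`, one has `e ^ (n + 1) f ^ (n + 1) v = (n + 1) e ^ n f ^ n (h - n) v`.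
      have h1 := ih (h v - (n : k) • v) (by rw [e_sub, hev]; simp) (by
        rw [pow_succ, End.mul_apply, S.e_f_pow, hev, map_zero, zero_add, map_smul,
          smul_eq_zero] at hn
        exact hn.resolve_left (Nat.cast_add_one_ne_zero n))
      -- On the eigenvalues `0, …, n - 1` the operator `h - n` is invertible; correcting `v` by the
      -- resulting `u` leaves an eigenvector of eigenvalue `n`.
      have h2 : ∃ u ∈ ⨆ j : Fin n, h.eigenspace (j : k), h u - (n : k) • u = h v - (n : k) • v := by
        refine Submodule.iSup_induction _
          (motive := fun x => ∃ u ∈ ⨆ j : Fin n, h.eigenspace (j : k), h u - (n : k) • u = x) h1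
          (fun j x hx => ?_) ⟨0, by simp⟩ ?_
        · have hj : ((j : ℕ) - n : k) ≠ 0 := by
            rw [sub_ne_zero]; exact_mod_cast (j.2.ne : (j : ℕ) ≠ n)
          refine ⟨((j : ℕ) - n : k)⁻¹ • x, Submodule.smul_mem _ _
            (Submodule.mem_iSup_of_mem j hx), ?_⟩
          rw [map_smul, End.mem_eigenspace_iff.1 hx, smul_comm (n : k), ← smul_sub, ← sub_smul,
            inv_smul_smul₀ hj]
        · rintro x y ⟨a, ha, rfl⟩ ⟨b, hb, rfl⟩
          exact ⟨a + b, Submodule.add_mem _ ha hb, by rw [map_add, smul_add]; abel⟩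
      obtain ⟨u, hu, hu'⟩ := h2
      have h3 : v - u ∈ h.eigenspace ((Fin.last n : ℕ) : k) := by
        rw [End.mem_eigenspace_iff, map_sub, smul_sub, ← sub_eq_zero, Fin.val_last]
        rw [← sub_eq_zero] at hu'
        rw [← neg_eq_zero, ← hu']; abel
      rw [← sub_add_cancel v u]
      refine Submodule.add_mem _ (Submodule.mem_iSup_of_mem (Fin.last n) h3) ?_
      refine (iSup_le fun j : Fin n => ?_ : (⨆ j : Fin n, h.eigenspace (j : k)) ≤ _) hu
      exact le_iSup (fun j : Fin (n + 1) => h.eigenspace (j : k)) j.castSucc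
  have ker_e' : ∀ v, e v = 0 → v ∈ E := by
    intro v hv
    obtain ⟨n, hn⟩ := hf v
    exact (iSup_le fun j : Fin n => le_iSup h.eigenspace _ :
      (⨆ j : Fin n, h.eigenspace (j : k)) ≤ E) (ker_e n v hv (by rw [hn, map_zero]))
  -- `h` is semisimple on `E`
  have semis : ∀ (c : k), ∀ x ∈ E, h (h x - c • x) = c • (h x - c • x) → h x = c • x := by
    intro c x hx hxc
    let g : End k V := (h - algebraMap k _ c) * (h - algebraMap k _ c)
    have hg : ∀ y, g y = h (h y - c • y) - c • (h y - c • y) := fun y => by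
      simp [g, Module.algebraMap_end_apply]
    have h1 := Submodule.mem_iSup_inf_of_eigenvectors (fun _ : Unit => h)
      (wt := fun (c : k) _ => c) (fun a b hab => congrFun hab ())
      (P := LinearMap.ker g) (by
        intro _ v hv
        rw [LinearMap.mem_ker, hg] at hv ⊢
        have := congrArg h hv
        simpa [map_sub, map_smul] using this) h.eigenspace
      (fun χ v hv _ => End.mem_eigenspace_iff.1 hv) hx
      (by rw [LinearMap.mem_ker, hg, hxc, sub_self])
    rw [← End.mem_eigenspace_iff]
    refine (iSup_le fun d y hy => ?_ : (⨆ χ, h.eigenspace χ ⊓ LinearMap.ker g) ≤ _) h1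
    obtain ⟨hy1, hy2⟩ := hy
    rw [SetLike.mem_coe, End.mem_eigenspace_iff] at hy1
    rw [SetLike.mem_coe, LinearMap.mem_ker, hg, hy1, ← sub_smul, map_smul, hy1, smul_smul,
      smul_smul, ← sub_smul, smul_eq_zero, mul_comm, ← sub_mul, mul_self_eq_zero] at hy2
    rcases hy2 with hy2 | hy2
    · rw [End.mem_eigenspace_iff, hy1, sub_eq_zero.1 hy2]
    · simp [hy2]
  have step : ∀ (d : ℕ) v, e v ∈ E → h v - (d : k) • v ∈ E → v ∈ E := by
    intro d v hev hv
    -- Since `h - d` is invertible on the other eigenspaces, `v` may be changed modulo `E` so that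
    -- `(h - d) v` is itself in the `d`-eigenspace.
    have h1 : ∃ u ∈ E, ∃ w, h w = (d : k) • w ∧ h v - (d : k) • v = w + (h u - (d : k) • u) := by
      refine Submodule.iSup_induction _ (motive := fun x => ∃ u ∈ E, ∃ w, h w = (d : k) • w ∧
        x = w + (h u - (d : k) • u)) hv (fun c x hx => ?_) ⟨0, by simp, 0, by simp⟩ ?_
      · have hx' := End.mem_eigenspace_iff.1 hx
        by_cases hc : c = d
        · exact ⟨0, by simp, x, hc ▸ hx', by simp⟩
        · refine ⟨(c - d : k)⁻¹ • x, E.smul_mem _ (mem_E c x hx'), 0, by simp, ?_⟩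
          rw [map_smul, hx', smul_comm (d : k), ← smul_sub, ← sub_smul,
            inv_smul_smul₀ (sub_ne_zero.2 hc), zero_add]
      · rintro x y ⟨a, ha, w, hw, rfl⟩ ⟨b, hb, w', hw', rfl⟩
        refine ⟨a + b, E.add_mem ha hb, w + w', by rw [map_add, hw, hw', smul_add], ?_⟩
        rw [map_add, smul_add]; abel
    obtain ⟨u, hu, w, hw, huw⟩ := h1
    set v' := v - u with hv'
    have hv'w : h v' - (d : k) • v' = w := by
      rw [hv', map_sub, smul_sub, sub_sub_sub_comm, huw, add_sub_cancel_right]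
    have hev' : e v' ∈ E := by rw [hv', map_sub]; exact E.sub_mem hev (E_e u hu)
    -- A priori `e v'` is only killed by `(h - (d + 2)) ^ 2`, but it lies in `E`, where `h` is
    -- diagonal.
    have h2 : h (e v') = (d + 2 : k) • e v' := by
      refine semis _ _ hev' ?_
      rw [← e_sub, hv'w, S.h_e, hw, map_smul]; module
    obtain ⟨p, hp⟩ := he (e v')
    -- With `j = 0` and `t = d + 1` the eigenvalue `2 j + 1 + t` is `d + 2`, and `y` is a
    -- `d`-eigenvector with the same image under `e` as `v'`. So `v'` is `y` plus an element of the
    -- kernel of `e`.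
    obtain ⟨y, hy, hhy⟩ := S.exists_e_eq p 0 (d + 1) (e v')
      (by rw [h2]; push_cast; module) hp
    have h3 : v' - y ∈ E := ker_e' _ (by rw [map_sub, hy]; simp)
    have h4 := E.add_mem (E.add_mem h3 (mem_E _ y hhy)) hu
    rwa [sub_add_cancel, hv', sub_add_cancel] at h4
  -- The argument for the kernel of `e`, repeated modulo the stable subspace `E`.
  have step' : ∀ (n : ℕ) v, e v ∈ E → (e ^ n) ((f ^ n) v) ∈ E → v ∈ E := by
    intro n
    induction n with
    | zero => intro v _ hv; simpa using hv
    | succ n ih =>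
      intro v hev hn
      refine step n v hev (ih _ ?_ ?_)
      · rw [e_sub]
        exact E.sub_mem (E_h _ hev) (E.smul_mem _ hev)
      · rw [pow_succ, End.mul_apply, S.e_f_pow, map_add, map_smul, E.add_mem_iff_right
          (E_pow e E_e _ _ (E_pow f E_f _ _ hev)),
          E.smul_mem_iff (Nat.cast_add_one_ne_zero n)] at hn
        exact hn
  have all : ∀ (p : ℕ) v, (e ^ p) v = 0 → v ∈ E := by
    intro p
    induction p with
    | zero => intro v hv; simp [show v = 0 by simpa using hv]
    | succ p ih =>
      intro v hv
      obtain ⟨n, hn⟩ := hf v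
      exact step' n v (ih _ (by rwa [pow_succ] at hv)) (by rw [hn, map_zero]; exact E.zero_mem)
  refine eq_top_iff.2 fun v _ => ?_
  obtain ⟨p, hp⟩ := he v
  exact all p v hp

end SlTwoAction

/-- Commuting diagonalizable endomorphisms are simultaneously diagonalizable. -/
lemma Module.End.iSup_iInf_eigenspace_eq_top {ι : Type*} [Finite ι] (h : ι → End k V)
    (hcomm : ∀ i j, Commute (h i) (h j)) (hdiag : ∀ i, ⨆ c, (h i).eigenspace c = ⊤) :
    ⨆ χ : ι → k, ⨅ i, (h i).eigenspace (χ i) = ⊤ := by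
  classical
  cases nonempty_fintype ι
  suffices H : ∀ s : Finset ι, ⨆ χ : ι → k, ⨅ i ∈ s, (h i).eigenspace (χ i) = ⊤ by
    simpa using H Finset.univ
  intro s
  induction s using Finset.induction_on with
  | empty => simp
  | insert a s ha ih =>
    rw [eq_top_iff, ← ih]
    refine iSup_le fun χ v hv => ?_
    have h1 := Submodule.mem_iSup_inf_of_eigenvectors (fun _ : Unit => h a)
      (wt := fun (c : k) _ => c) (fun a b hab => congrFun hab ())
      (P := ⨅ i ∈ s, (h i).eigenspace (χ i)) (by
        intro _ v hv
        simp only [Submodule.mem_iInf, End.mem_eigenspace_iff] at hv ⊢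
        intro i hi
        rw [← End.mul_apply, (hcomm i a).eq, End.mul_apply, hv i hi, map_smul])
      (h a).eigenspace (fun χ v hv _ => End.mem_eigenspace_iff.1 hv)
      (by rw [hdiag]; trivial) hv
    refine (iSup_le fun c => ?_ : (⨆ c, (h a).eigenspace c ⊓ _) ≤ _) h1
    refine le_trans ?_ (le_iSup _ (Function.update χ a c))
    refine le_iInf₂ fun i hi => ?_
    by_cases hia : i = a
    · subst hia; simp
    · rw [Function.update_of_ne hia]
      exact inf_le_right.trans (iInf₂_le i ((Finset.mem_insert.1 hi).resolve_left hia))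

end SlTwo

namespace RootGradedLieAlgebra

attribute [local instance] LieRing.ofAssociativeRing

variable {k L : Type u} [Field k] [CharZero k] [LieRing L] [LieAlgebra k L]
variable (D : RootGradedLieAlgebra k L)

/-! ### The cone spanned by the positive roots -/

lemma apply_coroot (i j : D.ι) : D.Θ.root i (D.Θ.coroot j) = (D.Θ.pairingIn ℤ i j : k) := by
  have h := D.Θ.algebraMap_pairingIn ℤ i j
  rw [← D.Θ.root'_coroot_eq_pairing, RootPairing.root', D.Θ_pairing] at h
  simpa using h.symm

variable {D}

lemma exists_root_eq {α : Dual k D.H} (h : α ∈ D.Θpos) : ∃ i, D.Θ.root i = α := by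
  have : α ∈ Set.range D.Θ.root := by
    rw [D.isPositiveSystem.eq_union]; exact Or.inl h
  exact this

variable (D)

/-- If positive roots sum to zero, evaluation at the coroot of one of them, `α`, shows that another
one, `β`, pairs negatively with `α`: otherwise the value would be at least `2`. Then `α + β` is a
positive root, and replacing the pair by it shortens the sum. -/
lemma multiset_sum_ne_zero (n : ℕ) : ∀ s : Multiset (Dual k D.H), s.card = n + 1 →
    (∀ α ∈ s, α ∈ D.Θpos) → s.sum ≠ 0 := by
  classical
  induction n with
  | zero =>
    intro s hs hpos
    obtain ⟨α, rfl⟩ := Multiset.card_eq_one.1 hs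
    obtain ⟨i, rfl⟩ := exists_root_eq (hpos α (by simp))
    simpa using D.Θ.ne_zero i
  | succ n ih =>
    intro s hs hpos hsum
    obtain ⟨α, t, rfl⟩ := Multiset.card_pos_iff_exists_mem.1 (by omega : 0 < s.card) |>.imp
      fun α h => Multiset.exists_cons_of_mem h
    have hα := hpos α (Multiset.mem_cons_self _ _)
    obtain ⟨i, rfl⟩ := exists_root_eq hα
    have hneg : ∃ j, D.Θ.root j ∈ t ∧ D.Θ.pairingIn ℤ j i < 0 := by
      by_contra! hcon
      have key : ∀ t' : Multiset (Dual k D.H), t' ≤ t →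
          ∃ m : ℕ, t'.sum (D.Θ.coroot i) = m := by
        intro t'
        induction t' using Multiset.induction_on with
        | empty => intro _; exact ⟨0, by simp⟩
        | cons β t' ih' =>
          intro hle
          obtain ⟨m, hm⟩ := ih' ((Multiset.le_cons_self _ _).trans hle)
          have hβt : β ∈ t := Multiset.mem_of_le hle (Multiset.mem_cons_self _ _)
          obtain ⟨j, rfl⟩ := exists_root_eq (hpos β (Multiset.mem_cons_of_mem hβt))
          obtain ⟨p, hp⟩ := Int.eq_ofNat_of_zero_le (hcon j hβt)
          refine ⟨p + m, ?_⟩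
          rw [Multiset.sum_cons, LinearMap.add_apply, hm, D.apply_coroot, hp]
          push_cast; rfl
      obtain ⟨m, hm⟩ := key t le_rfl
      have := congrArg (fun φ : Dual k D.H => φ (D.Θ.coroot i)) hsum
      simp only [Multiset.sum_cons, LinearMap.add_apply, hm, D.apply_coroot,
        RootPairing.pairingIn_same, LinearMap.zero_apply] at this
      have h2 : ((2 + m : ℕ) : k) = 0 := by rw [← this]; push_cast; rfl
      rw [Nat.cast_eq_zero] at h2
      omega
    obtain ⟨j, hjt, hj⟩ := hneg
    obtain ⟨t', rfl⟩ := Multiset.exists_cons_of_mem hjt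
    have hβ := hpos (D.Θ.root j) (by simp)
    have hroot : D.Θ.root j + D.Θ.root i ∈ Set.range D.Θ.root :=
      D.Θ.root_add_root_mem_of_pairingIn_neg hj fun h =>
        D.isPositiveSystem.neg_notMem _ hα (h ▸ hβ)
    refine ih ((D.Θ.root j + D.Θ.root i) ::ₘ t') (by simpa using hs) ?_ ?_
    · intro γ hγ
      rcases Multiset.mem_cons.1 hγ with rfl | hγ
      · exact D.isPositiveSystem.add_mem _ hβ _ hα hroot
      · exact hpos γ (by simp [hγ])
    · rw [← hsum]
      simp only [Multiset.sum_cons]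
      abel

variable {D}

lemma Θpos_subset_posCone {α : Dual k D.H} (h : α ∈ D.Θpos) : α ∈ D.posCone :=
  AddSubmonoid.subset_closure h

/-- The cone `ℕ[Θ₊]` is pointed. -/
lemma add_posCone_ne_zero {α γ : Dual k D.H} (hα : α ∈ D.Θpos) (hγ : γ ∈ D.posCone) :
    α + γ ≠ 0 := by
  obtain ⟨s, hs, rfl⟩ := AddSubmonoid.exists_multiset_of_mem_closure hγ
  have := D.multiset_sum_ne_zero s.card (α ::ₘ s) (by simp) (by
    intro β hβ
    rcases Multiset.mem_cons.1 hβ with rfl | hβ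
    exacts [hα, hs β hβ])
  simpa using this

lemma neg_notMem_posCone {α : Dual k D.H} (hα : α ∈ D.Θpos) : -α ∉ D.posCone :=
  fun h => add_posCone_ne_zero hα h (add_neg_cancel α)

variable (D)

lemma simpleRoot_mem_Θpos (i : D.base.support) : D.simpleRoot i ∈ D.Θpos := by
  have : D.simpleRoot i ∈ D.Θpos ∩ Set.range (LieAlgebra.IsKilling.rootSystem D.H).root := by
    rw [D.Θpos_inter]
    exact ⟨⟨i.1, rfl⟩, AddSubmonoid.subset_closure ⟨i.1, i.2, rfl⟩⟩
  exact this.1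

lemma simpleRoot_apply_simpleCoroot (i : D.base.support) :
    D.simpleRoot i (D.simpleCoroot i) = 2 :=
  (LieAlgebra.IsKilling.rootSystem D.H).root_coroot_two i.1

lemma span_simpleCoroot : Submodule.span k (Set.range D.simpleCoroot) = ⊤ := by
  have h := D.base.span_coroot_support
  rw [RootPairing.corootSpan, RootPairing.IsRootSystem.span_coroot_eq_top] at h
  rw [← h, Set.image_eq_range]
  rfl

/-! ### The weight space decomposition of `L` -/

lemma coe_e_mem (i : D.base.support) : (D.e i : L) ∈ D.rootSpace (D.simpleRoot i) := D.e_mem i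

lemma coe_f_mem (i : D.base.support) : (D.f i : L) ∈ D.rootSpace (-D.simpleRoot i) := D.f_mem i

variable {D}

lemma lie_mem_rootSpace {α β : Dual k D.H} {x y : L} (hx : x ∈ D.rootSpace α)
    (hy : y ∈ D.rootSpace β) : ⁅x, y⁆ ∈ D.rootSpace (α + β) := by
  intro h
  rw [leibniz_lie, hx h, hy h, smul_lie, lie_smul, LinearMap.add_apply, add_smul]

lemma rootSpace_le_Lpos {α : Dual k D.H} (hα : α ∈ D.Θpos) : D.rootSpace α ≤ D.Lpos :=
  le_iSup₂_of_le α hα le_rfl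

/-- An additive property of elements of `L` may be checked on `L_-`, `L_0` and `L_+`. -/
lemma induction_on_rootSpace {p : L → Prop} (x : L)
    (neg : ∀ β ∈ D.Θpos, ∀ x ∈ D.rootSpace (-β), p x) (zero : ∀ x ∈ D.rootSpace 0, p x)
    (pos : ∀ β ∈ D.Θpos, ∀ x ∈ D.rootSpace β, p x) (add : ∀ x y, p x → p y → p (x + y)) :
    p x := by
  have hx : x ∈ ⨆ α ∈ Set.range D.Θ.root ∪ {0}, adWeightSpace D.H α := by
    rw [D.iSup_eq_top]; trivial
  refine Submodule.iSup_induction _ (motive := p) hx (fun α x hx => ?_)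
    (zero 0 (Submodule.zero_mem _)) add
  refine Submodule.iSup_induction _ (motive := p) hx (fun hα x hx => ?_)
    (zero 0 (Submodule.zero_mem _)) add
  rcases hα with hα | rfl
  · rw [D.isPositiveSystem.eq_union] at hα
    rcases hα with hα | hα
    · exact pos α hα x hx
    · exact neg (-α) hα x (by rwa [neg_neg])
  · exact zero x hx

lemma rootSpace_eq_zero {ν : Dual k D.H} (hν : ν ∉ Set.range D.Θ.root ∪ {0}) {x : L}
    (hx : x ∈ D.rootSpace ν) : x = 0 := by
  have hx' : x ∈ ⨆ α, ⨆ (_ : α ∈ Set.range D.Θ.root ∪ {0}), adWeightSpace D.H α := by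
    rw [D.iSup_eq_top]; trivial
  have := Submodule.mem_of_mem_iSup_of_eigenvector
    (fun h : D.H => (LieAlgebra.ad k L ((h : D.g) : L) : End k L))
    (wt := fun (χ : Dual k D.H) h => χ h) DFunLike.coe_injective
    (fun α => ⨆ (_ : α ∈ Set.range D.Θ.root ∪ {0}), adWeightSpace D.H α)
    (fun χ v hv h => by
      by_cases hχ : χ ∈ Set.range D.Θ.root ∪ {0}
      · rw [iSup_pos hχ] at hv; exact hv h
      · rw [iSup_neg hχ, Submodule.mem_bot] at hv; simp [hv]) hx' (fun h => hx h)
  rwa [iSup_neg hν, Submodule.mem_bot] at this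

/-- The string `β + n α` consists of distinct weights in characteristic zero, so it leaves the
finite set `Θ ∪ {0}`. -/
lemma exists_ad_pow_eq_zero {α : Dual k D.H} (hα : α ≠ 0) {y : L} (hy : y ∈ D.rootSpace α)
    (x : L) : ∃ n : ℕ, ((LieAlgebra.ad k L y : End k L) ^ n) x = 0 := by
  have key : ∀ β, ∀ x ∈ D.rootSpace β, ∃ n : ℕ, ((LieAlgebra.ad k L y : End k L) ^ n) x = 0 := by
    intro β x hx
    have h1 : ∀ n : ℕ, ((LieAlgebra.ad k L y : End k L) ^ n) x ∈ D.rootSpace (n • α + β) := by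
      intro n
      induction n with
      | zero => simpa using hx
      | succ n ih =>
        rw [pow_succ', End.mul_apply, succ_nsmul', add_assoc]
        exact lie_mem_rootSpace hy ih
    have hinj : Function.Injective fun n : ℕ => n • α + β := by
      intro m n hmn
      have : (m : k) • α = (n : k) • α := by
        simpa only [Nat.cast_smul_eq_nsmul] using add_right_cancel hmn
      exact_mod_cast smul_left_injective k hα this
    have hfin : (Set.range D.Θ.root ∪ {0}).Finite :=
      (Set.finite_range _).union (Set.finite_singleton _)
    obtain ⟨n, hn⟩ : ∃ n : ℕ, n • α + β ∉ Set.range D.Θ.root ∪ {0} := by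
      by_contra! hcon
      exact Set.infinite_of_injective_forall_mem hinj hcon hfin
    exact ⟨n, rootSpace_eq_zero hn (h1 n)⟩
  refine induction_on_rootSpace x (fun β _ => key _) (key 0) (fun β _ => key β) ?_
  rintro a b ⟨m, hm⟩ ⟨n, hn⟩
  refine ⟨m + n, ?_⟩
  rw [map_add, pow_add, End.mul_apply, End.mul_apply, hn, map_zero, add_zero,
    ← End.mul_apply, ← pow_add, add_comm m n, pow_add, End.mul_apply, hm, map_zero]

/-- Without simple coroots `𝔥 = 0`, so `Θ` has no roots and `L = L_0` is an empty sum of brackets.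
This degenerate case needs separate care because `J^λ` then has no generators. -/
lemma subsingleton_of_isEmpty (h : IsEmpty D.base.support) : Subsingleton L := by
  have h1 : (⊤ : Submodule k D.H) = ⊥ := by
    rw [← D.span_simpleCoroot, Set.range_eq_empty, Submodule.span_empty]
  have hH : Subsingleton D.H := (Submodule.subsingleton_iff k).1 (subsingleton_of_top_eq_bot h1)
  have hι : IsEmpty D.ι := ⟨fun i => D.Θ.ne_zero i (Subsingleton.elim _ _)⟩
  have h0 : adWeightSpace D.H 0 = (⊤ : Submodule k L) := by
    rw [← D.iSup_eq_top, Set.range_eq_empty, Set.empty_union, iSup_singleton]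
  have h2 : (⊤ : Submodule k L) = ⊥ := by
    rw [← h0, D.zero_eq, Submodule.span_eq_bot]
    rintro x ⟨i, _⟩
    exact isEmptyElim i
  exact (Submodule.subsingleton_iff k).1 (subsingleton_of_top_eq_bot h2)

end RootGradedLieAlgebra

-- Generation of the enveloping algebra by the Lie algebra

attribute [local instance] LieRing.ofAssociativeRing in
lemma UniversalEnvelopingAlgebra.adjoin_range_ι (k : Type*) {L : Type*} [CommRing k] [LieRing L]
    [LieAlgebra k L] : Algebra.adjoin k (Set.range (UniversalEnvelopingAlgebra.ι k (L := L))) = ⊤ := by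
  set C := Algebra.adjoin k (Set.range (UniversalEnvelopingAlgebra.ι k (L := L)))
  let s : L →ₗ⁅k⁆ C :=
    { toFun := fun x => ⟨UniversalEnvelopingAlgebra.ι k x, Algebra.subset_adjoin ⟨x, rfl⟩⟩
      map_add' := by intro x y; ext; simp
      map_smul' := by intro c x; ext; simp
      map_lie' := by
        intro x y
        ext
        simp [LieRing.of_associative_ring_bracket] }
  have hid : C.val.comp (UniversalEnvelopingAlgebra.lift k s) = AlgHom.id k _ := by
    apply UniversalEnvelopingAlgebra.hom_ext
    ext x
    change C.val (UniversalEnvelopingAlgebra.lift k s (UniversalEnvelopingAlgebra.ι k x)) = _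
    rw [UniversalEnvelopingAlgebra.lift_ι_apply]
    rfl
  refine eq_top_iff.2 fun a _ => ?_
  have h2 : ((UniversalEnvelopingAlgebra.lift k s a : C) : UniversalEnvelopingAlgebra k L) = a :=
    DFunLike.congr_fun hid a
  exact h2 ▸ (UniversalEnvelopingAlgebra.lift k s a).2

lemma UniversalEnvelopingAlgebra.induction_on {k L : Type*} [CommRing k] [LieRing L]
    [LieAlgebra k L] {p : UniversalEnvelopingAlgebra k L → Prop} (a : UniversalEnvelopingAlgebra k L)
    (algebraMap : ∀ c, p (algebraMap k _ c)) (ι : ∀ x : L, p (UniversalEnvelopingAlgebra.ι k x))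
    (add : ∀ a b, p a → p b → p (a + b)) (mul : ∀ a b, p a → p b → p (a * b)) : p a := by
  have ha : a ∈ Algebra.adjoin k (Set.range (UniversalEnvelopingAlgebra.ι k (L := L))) := by
    rw [UniversalEnvelopingAlgebra.adjoin_range_ι]; trivial
  refine Algebra.adjoin_induction (p := fun a _ => p a) ?_ algebraMap (fun a b _ _ => add a b)
    (fun a b _ _ => mul a b) ha
  rintro _ ⟨x, rfl⟩
  exact ι x

namespace RootGradedLieAlgebra

attribute [local instance] LieRing.ofAssociativeRing

variable {k L : Type u} [Field k] [CharZero k] [LieRing L] [LieAlgebra k L]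
variable (D : RootGradedLieAlgebra k L)

lemma incl_zero : D.incl 0 = 0 := (UniversalEnvelopingAlgebra.ι k (L := L)).toLinearMap.map_zero

lemma incl_add (x y : L) : D.incl (x + y) = D.incl x + D.incl y :=
  (UniversalEnvelopingAlgebra.ι k (L := L)).toLinearMap.map_add x y

lemma incl_smul (c : k) (x : L) : D.incl (c • x) = c • D.incl x :=
  (UniversalEnvelopingAlgebra.ι k (L := L)).toLinearMap.map_smul c x

lemma incl_lie (x y : L) : D.incl ⁅x, y⁆ = D.incl x * D.incl y - D.incl y * D.incl x :=
  (UniversalEnvelopingAlgebra.ι k (L := L)).map_lie x y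

lemma incl_mul_incl (x y : L) : D.incl x * D.incl y = D.incl ⁅x, y⁆ + D.incl y * D.incl x := by
  rw [incl_lie]; abel

lemma U0ToU_ι (x : D.L0) : D.U0ToU (UniversalEnvelopingAlgebra.ι k x) = D.incl x :=
  UniversalEnvelopingAlgebra.lift_ι_apply k _ x

/-! ### Words in `L_-` -/

section Words

variable {V : Type*} [AddCommGroup V] [Module k V] [Module D.U V] [IsScalarTower k D.U V]

/-- `NegWord D S γ v` means that `v = x₁ ⋯ xₙ s` with `s ∈ S`, `xⱼ ∈ L_{-βⱼ}`, `βⱼ ∈ Θ₊` and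
`γ = ∑ βⱼ`. -/
inductive NegWord (S : Set V) : Dual k D.H → V → Prop
  | base (s : V) (hs : s ∈ S) : NegWord S 0 s
  | cons (β : Dual k D.H) (hβ : β ∈ D.Θpos) (x : L) (hx : x ∈ D.rootSpace (-β))
      (γ : Dual k D.H) (v : V) (hv : NegWord S γ v) : NegWord S (β + γ) (D.incl x • v)

/-- The span of the words in `L_-` applied to elements of `S`. -/
def negSpan (S : Set V) : Submodule k V := Submodule.span k {v | ∃ γ, NegWord D S γ v}

variable {D}

omit [Module k V] [IsScalarTower k D.U V] in
lemma NegWord.mem_posCone {S : Set V} {γ : Dual k D.H} {v : V} (h : NegWord D S γ v) :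
    γ ∈ D.posCone := by
  induction h with
  | base s hs => exact zero_mem _
  | cons β hβ x hx γ v hv ih => exact add_mem (Θpos_subset_posCone hβ) ih

omit [Module k V] [IsScalarTower k D.U V] in
lemma NegWord.mem_of_eq_zero {S : Set V} {γ : Dual k D.H} {v : V} (h : NegWord D S γ v)
    (hγ : γ = 0) : v ∈ S := by
  cases h with
  | base s hs => exact hs
  | cons β hβ x hx γ v hv => exact absurd hγ (add_posCone_ne_zero hβ hv.mem_posCone)

/-- Weights of words, for a family of operators `φ h` that act on words like `h` does. -/
lemma NegWord.apply_eq_smul {S : Set V} {γ μ : Dual k D.H} {v : V} (hw : NegWord D S γ v)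
    (φ : D.H → End k V)
    (hφ : ∀ h x v, φ h (D.incl x • v) = D.incl x • φ h v + D.incl ⁅((h : D.g) : L), x⁆ • v)
    (hS : ∀ s ∈ S, ∀ h, φ h s = μ h • s) (h : D.H) : φ h v = (μ - γ) h • v := by
  induction hw with
  | base s hs => simpa using hS s hs h
  | cons β hβ x hx γ v hv ih =>
    rw [hφ, ih, hx h, incl_smul, smul_assoc, smul_comm (D.incl x), ← add_smul]
    congr 1
    simp only [LinearMap.sub_apply, LinearMap.add_apply, LinearMap.neg_apply]
    ring

variable (D)

lemma incl_smul_mem_negSpan_of_neg (S : Set V) {β : Dual k D.H} (hβ : β ∈ D.Θpos) {x : L}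
    (hx : x ∈ D.rootSpace (-β)) {v : V} (hv : v ∈ D.negSpan S) : D.incl x • v ∈ D.negSpan S := by
  refine (Submodule.span_le (p := (D.negSpan S).comap (Algebra.lsmul k k V (D.incl x)))).2 ?_ hv
  rintro v ⟨γ, hv⟩
  exact Submodule.subset_span ⟨_, hv.cons β hβ x hx⟩

/-- The rewriting `x y v = [x, y] v + y x v` moves any `x ∈ L` through a word. The induction on the
word is for all `x` at once, since `[x, y]` can lie in any part of `L`; no ordering of the letters
is involved. -/
lemma smul_mem_negSpan {S : Set V}
    (h0 : ∀ x ∈ D.rootSpace 0, ∀ s ∈ S, D.incl x • s ∈ Submodule.span k S)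
    (hpos : ∀ β ∈ D.Θpos, ∀ x ∈ D.rootSpace β, ∀ s ∈ S, D.incl x • s ∈ Submodule.span k S)
    (a : D.U) {v : V} (hv : v ∈ D.negSpan S) : a • v ∈ D.negSpan S := by
  have hS : Submodule.span k S ≤ D.negSpan S :=
    Submodule.span_mono fun s hs => ⟨0, .base s hs⟩
  have key : ∀ γ v, NegWord D S γ v → ∀ x : L, D.incl x • v ∈ D.negSpan S := by
    intro γ v hv
    induction hv with
    | base s hs =>
      intro x
      refine induction_on_rootSpace x (fun β hβ x hx => ?_) (fun x hx => hS (h0 x hx s hs))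
        (fun β hβ x hx => hS (hpos β hβ x hx s hs)) fun x y hx hy => ?_
      · exact Submodule.subset_span ⟨_, .cons β hβ x hx _ _ (.base s hs)⟩
      · rw [incl_add, add_smul]; exact add_mem hx hy
    | cons β hβ y hy γ v hv ih =>
      intro x
      rw [smul_smul, incl_mul_incl, add_smul, mul_smul]
      exact add_mem (ih _) (D.incl_smul_mem_negSpan_of_neg S hβ hy (ih x))
  have key' : ∀ (x : L), ∀ v ∈ D.negSpan S, D.incl x • v ∈ D.negSpan S := by
    intro x v hv
    refine (Submodule.span_le (p := (D.negSpan S).comap (Algebra.lsmul k k V (D.incl x)))).2 ?_ hv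
    rintro v ⟨γ, hv⟩
    exact key γ v hv x
  induction a using UniversalEnvelopingAlgebra.induction_on generalizing v with
  | algebraMap c => rw [algebraMap_smul]; exact Submodule.smul_mem _ _ hv
  | ι x => exact key' x v hv
  | add a b ha hb => rw [add_smul]; exact add_mem (ha hv) (hb hv)
  | mul a b ha hb => rw [mul_smul]; exact ha (hb hv)

end Words

/-! ### The weight space decomposition of `U(L)` -/

/-- The operator `ad h` on `U(L)`. -/
noncomputable def adU (h : D.H) : End k D.U :=
  LinearMap.mulLeft k (D.incl ((h : D.g) : L)) - LinearMap.mulRight k (D.incl ((h : D.g) : L))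

lemma adU_apply (h : D.H) (a : D.U) :
    D.adU h a = D.incl ((h : D.g) : L) * a - a * D.incl ((h : D.g) : L) := rfl

lemma adU_mul (h : D.H) (a b : D.U) : D.adU h (a * b) = D.adU h a * b + a * D.adU h b := by
  simp only [adU_apply, sub_mul, mul_sub, mul_assoc]; abel

lemma adU_incl (h : D.H) (x : L) : D.adU h (D.incl x) = D.incl ⁅((h : D.g) : L), x⁆ := by
  rw [adU_apply, incl_lie]

/-- The weight space `U(L)_ν`. -/
noncomputable def adWeight (ν : Dual k D.H) : Submodule k D.U where
  carrier := {a | ∀ h, D.adU h a = ν h • a}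
  zero_mem' := by simp
  add_mem' := by intro a b ha hb h; rw [map_add, ha h, hb h, smul_add]
  smul_mem' := by intro c a ha h; rw [_root_.map_smul, ha h, smul_comm]

variable {D}

lemma mem_adWeight {ν : Dual k D.H} {a : D.U} : a ∈ D.adWeight ν ↔ ∀ h, D.adU h a = ν h • a :=
  Iff.rfl

lemma mem_adWeight_zero {a : D.U} : a ∈ D.adWeight 0 ↔ a ∈ D.UZero := by
  simp [mem_adWeight, adU_apply, UZero, sub_eq_zero]

lemma mul_mem_adWeight {ν ρ σ : Dual k D.H} {a b : D.U} (ha : a ∈ D.adWeight ν)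
    (hb : b ∈ D.adWeight ρ) (hσ : σ = ν + ρ) : a * b ∈ D.adWeight σ := by
  intro h
  rw [adU_mul, ha h, hb h, hσ, LinearMap.add_apply, add_smul, smul_mul_assoc, mul_smul_comm]

lemma incl_mem_adWeight {ν : Dual k D.H} {x : L} (hx : x ∈ D.rootSpace ν) :
    D.incl x ∈ D.adWeight ν := by
  intro h
  rw [adU_incl, hx h, incl_smul]

lemma pow_mem_adWeight {ν : Dual k D.H} {a : D.U} (ha : a ∈ D.adWeight ν) (n : ℕ) :
    a ^ n ∈ D.adWeight (n • ν) := by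
  induction n with
  | zero => intro h; simp [adU_apply]
  | succ n ih => rw [pow_succ]; exact mul_mem_adWeight ih ha (succ_nsmul _ _)

lemma U0ToU_mem_adWeight (b : D.U0) : D.U0ToU b ∈ D.adWeight 0 :=
  mem_adWeight_zero.2 (D.U0ToU_mem_UZero b)

lemma U0ToU_mul_mem_adWeight {ν : Dual k D.H} (b : D.U0) {a : D.U} (ha : a ∈ D.adWeight ν) :
    D.U0ToU b * a ∈ D.adWeight ν :=
  mul_mem_adWeight (U0ToU_mem_adWeight b) ha (zero_add _).symm

lemma mul_mem_leftIdealLpos (a : D.U) {b : D.U} (hb : b ∈ D.leftIdealLpos) :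
    a * b ∈ D.leftIdealLpos :=
  D.leftIdealLpos.smul_mem a hb

lemma incl_mem_leftIdealLpos {x : L} (hx : x ∈ D.Lpos) : D.incl x ∈ D.leftIdealLpos :=
  Submodule.subset_span ⟨x, hx, rfl⟩

/-- Elements of `L_β` may be moved to the right of elements of `U(L_0)`. -/
lemma incl_mul_U0ToU_mem (β : Dual k D.H) (b : D.U0) : ∀ x ∈ D.rootSpace β,
    D.incl x * D.U0ToU b ∈
      Submodule.span k {a | ∃ c, ∃ y ∈ D.rootSpace β, a = D.U0ToU c * D.incl y} := by
  set N := Submodule.span k {a | ∃ c, ∃ y ∈ D.rootSpace β, a = D.U0ToU c * D.incl y} with hN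
  have hmul : ∀ c, ∀ a ∈ N, D.U0ToU c * a ∈ N := by
    intro c a ha
    refine (Submodule.span_le (p := N.comap (LinearMap.mulLeft k (D.U0ToU c)))).2 ?_ ha
    rintro _ ⟨c', y, hy, rfl⟩
    refine Submodule.subset_span ⟨c * c', y, hy, ?_⟩
    rw [LinearMap.mulLeft_apply, map_mul, mul_assoc]
  induction b using UniversalEnvelopingAlgebra.induction_on with
  | algebraMap c =>
    intro x hx
    rw [AlgHom.commutes, ← Algebra.commutes, ← AlgHom.commutes D.U0ToU]
    exact Submodule.subset_span ⟨_, x, hx, rfl⟩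
  | ι y =>
    intro x hx
    rw [U0ToU_ι, incl_mul_incl]
    refine add_mem (Submodule.subset_span ⟨1, ⁅x, (y : L)⁆, ?_, by rw [map_one, one_mul]⟩)
      (Submodule.subset_span ⟨_, x, hx, by rw [U0ToU_ι]⟩)
    simpa using lie_mem_rootSpace hx y.2
  | add a b ha hb => intro x hx; rw [map_add, mul_add]; exact add_mem (ha x hx) (hb x hx)
  | mul a b ha hb =>
    intro x hx
    rw [map_mul, ← mul_assoc]
    refine (Submodule.span_le (p := N.comap (LinearMap.mulRight k (D.U0ToU b)))).2 ?_ (ha x hx)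
    rintro _ ⟨c, y, hy, rfl⟩
    rw [SetLike.mem_coe, Submodule.mem_comap, LinearMap.mulRight_apply, mul_assoc]
    exact hmul c _ (hb y hy)

/-- Each `L_β` is stable under `ad L_0`, so elements of `U(L_0)` can be moved to the left of
elements of `L_+`. This makes `proj` right linear over `U(L_0)`. -/
lemma mul_U0ToU_mem_leftIdealLpos {a : D.U} (ha : a ∈ D.leftIdealLpos) (b : D.U0) :
    a * D.U0ToU b ∈ D.leftIdealLpos := by
  refine Submodule.span_induction (p := fun a _ => a * D.U0ToU b ∈ D.leftIdealLpos) ?_ (by simp)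
    (fun a c _ _ ha hc => by rw [add_mul]; exact add_mem ha hc)
    (fun c a _ ha => by rw [smul_eq_mul, mul_assoc]; exact mul_mem_leftIdealLpos c ha) ha
  rintro _ ⟨x, hx, rfl⟩
  refine Submodule.iSup_induction _ (motive := fun x => D.incl x * D.U0ToU b ∈ D.leftIdealLpos) hx
    (fun β x hx => ?_) (by simp) (fun x y hx hy => by rw [incl_add, add_mul]; exact add_mem hx hy)
  refine Submodule.iSup_induction _ (motive := fun x => D.incl x * D.U0ToU b ∈ D.leftIdealLpos) hx
    (fun hβ x hx => ?_) (by simp) (fun x y hx hy => by rw [incl_add, add_mul]; exact add_mem hx hy)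
  refine (Submodule.span_le (p := D.leftIdealLpos.restrictScalars k)).2 ?_
    (incl_mul_U0ToU_mem β b x hx)
  rintro _ ⟨c, y, hy, rfl⟩
  exact mul_mem_leftIdealLpos _ (incl_mem_leftIdealLpos (rootSpace_le_Lpos hβ hy))

variable (D)

/-- `PosWord D δ p` means that `p = x₁ ⋯ xₘ` with `xⱼ ∈ L_{βⱼ}`, `βⱼ ∈ Θ₊` and `δ = ∑ βⱼ`. -/
def PosWord (δ : Dual k D.H) (p : D.U) : Prop :=
  ∃ (m : ℕ) (β : Fin m → Dual k D.H) (x : Fin m → L), (∀ j, β j ∈ D.Θpos) ∧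
    (∀ j, x j ∈ D.rootSpace (β j)) ∧ ∑ j, β j = δ ∧ (List.ofFn fun j => D.incl (x j)).prod = p

variable {D}

lemma PosWord.one : PosWord D 0 1 :=
  ⟨0, Fin.elim0, Fin.elim0, fun j => j.elim0, fun j => j.elim0, by simp, by simp⟩

lemma PosWord.cons {β δ : Dual k D.H} {p : D.U} (hβ : β ∈ D.Θpos) {x : L}
    (hx : x ∈ D.rootSpace β) (hp : PosWord D δ p) : PosWord D (β + δ) (D.incl x * p) := by
  obtain ⟨m, β', x', hβ', hx', rfl, rfl⟩ := hp
  refine ⟨m + 1, Fin.cons β β', Fin.cons x x', fun j => ?_, fun j => ?_, ?_, ?_⟩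
  · refine Fin.cases hβ (fun j => ?_) j; simpa using hβ' j
  · refine Fin.cases hx (fun j => ?_) j; simpa using hx' j
  · simp [Fin.sum_univ_succ]
  · simp [List.ofFn_succ]

lemma PosWord.mem_adWeight {δ : Dual k D.H} {p : D.U} (hp : PosWord D δ p) :
    p ∈ D.adWeight δ := by
  obtain ⟨m, β, x, hβ, hx, rfl, rfl⟩ := hp
  clear hβ
  induction m with
  | zero => intro h; simp [adU_apply]
  | succ m ih =>
    rw [List.ofFn_succ, List.prod_cons, Fin.sum_univ_succ]
    exact mul_mem_adWeight (incl_mem_adWeight (hx 0))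
      (ih (fun j => β j.succ) (fun j => x j.succ) fun j => hx j.succ) rfl

lemma PosWord.eq_one_or_mem {δ : Dual k D.H} {p : D.U} (hp : PosWord D δ p) :
    (δ = 0 ∧ p = 1) ∨ p ∈ D.leftIdealLpos := by
  obtain ⟨m, β, x, hβ, hx, rfl, rfl⟩ := hp
  cases m with
  | zero => left; simp
  | succ m =>
    right
    rw [List.ofFn_succ', List.concat_eq_append, List.prod_append, List.prod_singleton]
    exact mul_mem_leftIdealLpos _ (incl_mem_leftIdealLpos (rootSpace_le_Lpos (hβ _) (hx _)))

variable (D)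

/-- `TriWord D ν v` means that `v = n b p` with `n` a word in `L_-`, `b ∈ U(L_0)` and `p` a word in
`L_+`, and that `v` is of weight `ν`. -/
def TriWord (ν : Dual k D.H) (v : D.U) : Prop :=
  ∃ (b : D.U0) (δ : Dual k D.H) (p : D.U) (γ : Dual k D.H),
    PosWord D δ p ∧ NegWord D {D.U0ToU b * p} γ v ∧ ν = δ - γ

variable {D}

lemma NegWord.mem_adWeight {ν γ : Dual k D.H} {g v : D.U} (hg : g ∈ D.adWeight ν)
    (hv : NegWord D {g} γ v) : v ∈ D.adWeight (ν - γ) :=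
  hv.apply_eq_smul D.adU (fun h x v => by
    rw [smul_eq_mul, adU_mul, adU_incl, add_comm, smul_eq_mul, smul_eq_mul])
    (fun s hs => by rw [Set.mem_singleton_iff.1 hs]; exact hg)

lemma TriWord.mem_adWeight {ν : Dual k D.H} {v : D.U} (hv : TriWord D ν v) :
    v ∈ D.adWeight ν := by
  obtain ⟨b, δ, p, γ, hp, hv, rfl⟩ := hv
  exact hv.mem_adWeight (U0ToU_mul_mem_adWeight b hp.mem_adWeight)

lemma NegWord.mem_leftIdealLpos {γ : Dual k D.H} {g v : D.U} (hg : g ∈ D.leftIdealLpos)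
    (hv : NegWord D {g} γ v) : v ∈ D.leftIdealLpos := by
  induction hv with
  | base s hs => rwa [Set.mem_singleton_iff.1 hs]
  | cons β hβ x hx γ v hv ih => exact mul_mem_leftIdealLpos _ ih

/-- A nonempty `L_+`-part puts the word in `U(L) L_+`. Otherwise the weight is minus the degree of
the `L_-`-part, and degree zero forces that part to be empty since the cone is pointed. -/
lemma TriWord.cases {ν : Dual k D.H} {v : D.U} (hv : TriWord D ν v) :
    v ∈ D.leftIdealLpos ∨ (-ν ∈ D.posCone ∧ (ν = 0 → ∃ b, v = D.U0ToU b)) := by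
  obtain ⟨b, δ, p, γ, hp, hv, rfl⟩ := hv
  rcases hp.eq_one_or_mem with ⟨rfl, rfl⟩ | hp'
  · right
    refine ⟨by simpa using hv.mem_posCone, fun h => ⟨b, ?_⟩⟩
    simpa using hv.mem_of_eq_zero (by simpa using h)
  · exact Or.inl (hv.mem_leftIdealLpos (mul_mem_leftIdealLpos _ hp'))

/-- The triangular decomposition `U(L) = U(L_-) U(L_0) U(L_+)`. -/
lemma mem_iSup_span_TriWord (a : D.U) : a ∈ ⨆ ν, Submodule.span k {v | TriWord D ν v} := by
  set S : Set D.U := {g | ∃ b δ p, PosWord D δ p ∧ g = D.U0ToU b * p} with hS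
  have h1 : a • (1 : D.U) ∈ D.negSpan S := by
    refine D.smul_mem_negSpan ?_ ?_ a
      (Submodule.subset_span ⟨0, .base 1 ⟨1, 0, 1, .one, by simp⟩⟩)
    · rintro x hx _ ⟨b, δ, p, hp, rfl⟩
      refine Submodule.subset_span ⟨UniversalEnvelopingAlgebra.ι k (⟨x, hx⟩ : D.L0) * b, δ, p, hp, ?_⟩
      rw [map_mul, U0ToU_ι, smul_eq_mul, mul_assoc]
    · rintro β hβ x hx _ ⟨b, δ, p, hp, rfl⟩
      rw [smul_eq_mul, ← mul_assoc]
      refine (Submodule.span_le (p := (Submodule.span k S).comap (LinearMap.mulRight k p))).2 ?_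
        (incl_mul_U0ToU_mem β b x hx)
      rintro _ ⟨c, y, hy, rfl⟩
      exact Submodule.subset_span ⟨c, β + δ, D.incl y * p, hp.cons hβ hy, by
        rw [LinearMap.mulRight_apply, mul_assoc]⟩
  rw [smul_eq_mul, mul_one] at h1
  refine (Submodule.span_le (p := ⨆ ν, Submodule.span k {v | TriWord D ν v})).2 ?_ h1
  rintro v ⟨γ, hv⟩
  -- A word ends in a single element of `S`, whose weight is needed to determine the weight of the
  -- word.
  have : ∃ g ∈ S, NegWord D {g} γ v := by
    induction hv with
    | base s hs => exact ⟨s, hs, .base s rfl⟩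
    | cons β hβ x hx γ v hv ih =>
      obtain ⟨g, hg, ih⟩ := ih
      exact ⟨g, hg, .cons β hβ x hx γ v ih⟩
  obtain ⟨_, ⟨b, δ, p, hp, rfl⟩, hv⟩ := this
  exact Submodule.mem_iSup_of_mem (δ - γ) (Submodule.subset_span ⟨b, δ, p, γ, hp, hv, rfl⟩)

lemma span_TriWord_le (ν : Dual k D.H) : Submodule.span k {v | TriWord D ν v} ≤ D.adWeight ν :=
  Submodule.span_le.2 fun _ hv => TriWord.mem_adWeight hv

lemma iSup_adWeight : ⨆ ν, D.adWeight ν = ⊤ :=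
  eq_top_iff.2 fun a _ => iSup_mono span_TriWord_le (mem_iSup_span_TriWord a)

lemma mem_span_TriWord {ν : Dual k D.H} {a : D.U} (ha : a ∈ D.adWeight ν) :
    a ∈ Submodule.span k {v | TriWord D ν v} :=
  Submodule.mem_of_mem_iSup_of_eigenvector D.adU (wt := fun (χ : Dual k D.H) h => χ h)
    DFunLike.coe_injective (fun ν => Submodule.span k {v | TriWord D ν v})
    (fun ν _ hv => span_TriWord_le ν hv) (mem_iSup_span_TriWord a) ha

lemma mem_leftIdealLpos_of_notMem {ν : Dual k D.H} (hν : -ν ∉ D.posCone) {a : D.U}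
    (ha : a ∈ D.adWeight ν) : a ∈ D.leftIdealLpos := by
  refine (Submodule.span_le (p := D.leftIdealLpos.restrictScalars k)).2 (fun v hv => ?_)
    (mem_span_TriWord ha)
  exact (TriWord.cases hv).resolve_right fun h => hν h.1

/-- The Harish-Chandra decomposition `U(L)_0 = U(L_0) + K`. -/
lemma exists_isHarishChandra {a : D.U} (ha : a ∈ D.adWeight 0) : ∃ z, D.IsHarishChandra a z := by
  suffices ∃ z, a - D.U0ToU z ∈ D.leftIdealLpos by
    obtain ⟨z, hz⟩ := this
    exact ⟨z, mem_adWeight_zero.1 ha, hz,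
      mem_adWeight_zero.1 (sub_mem ha (U0ToU_mem_adWeight z))⟩
  refine Submodule.span_induction (p := fun a _ => ∃ z, a - D.U0ToU z ∈ D.leftIdealLpos) ?_
    ⟨0, by simp⟩ ?_ ?_ (mem_span_TriWord ha)
  · intro v hv
    rcases TriWord.cases hv with h | ⟨-, h⟩
    · exact ⟨0, by simpa using h⟩
    · obtain ⟨b, rfl⟩ := h rfl
      exact ⟨b, by simp⟩
  · rintro a b - - ⟨y, hy⟩ ⟨z, hz⟩
    exact ⟨y + z, by rw [map_add, add_sub_add_comm]; exact add_mem hy hz⟩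
  · rintro c a - ⟨z, hz⟩
    refine ⟨c • z, ?_⟩
    rw [_root_.map_smul, ← smul_sub, Algebra.smul_def]
    exact mul_mem_leftIdealLpos _ hz

/-! ### The projection of `U(L)` onto the Seligman algebra -/

variable (D)

/-- The sum of `U(L) L_+` and all weight spaces of `U(L)` of nonzero weight. -/
noncomputable def projKer : Submodule k D.U :=
  D.leftIdealLpos.restrictScalars k ⊔ ⨆ (ν : Dual k D.H) (_ : ν ≠ 0), D.adWeight ν

variable {D}

lemma mem_projKer_of_mem_leftIdealLpos {a : D.U} (h : a ∈ D.leftIdealLpos) : a ∈ D.projKer :=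
  Submodule.mem_sup_left h

lemma mem_projKer_of_mem_adWeight {ν : Dual k D.H} (hν : ν ≠ 0) {a : D.U}
    (h : a ∈ D.adWeight ν) : a ∈ D.projKer :=
  Submodule.mem_sup_right (Submodule.mem_iSup_of_mem ν (Submodule.mem_iSup_of_mem hν h))

lemma projKer_induction {p : D.U → Prop} {a : D.U} (ha : a ∈ D.projKer)
    (left : ∀ a ∈ D.leftIdealLpos, p a) (weight : ∀ ν ≠ 0, ∀ a ∈ D.adWeight ν, p a)
    (add : ∀ a b, p a → p b → p (a + b)) : p a := by
  obtain ⟨b, hb, c, hc, rfl⟩ := Submodule.mem_sup.1 ha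
  refine add _ _ (left b hb) ?_
  refine Submodule.iSup_induction _ (motive := p) hc (fun ν x hx => ?_)
    (left 0 (zero_mem _)) add
  exact Submodule.iSup_induction _ (motive := p) hx (fun hν x hx => weight ν hν x hx)
    (left 0 (zero_mem _)) add

lemma U0ToU_mul_mem_projKer (b : D.U0) {a : D.U} (ha : a ∈ D.projKer) :
    D.U0ToU b * a ∈ D.projKer := by
  refine projKer_induction (p := fun a => D.U0ToU b * a ∈ D.projKer) ha
    (fun a ha => mem_projKer_of_mem_leftIdealLpos (mul_mem_leftIdealLpos _ ha))
    (fun ν hν a ha => mem_projKer_of_mem_adWeight hν (U0ToU_mul_mem_adWeight b ha))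
    (fun a c ha hc => by rw [mul_add]; exact add_mem ha hc)

lemma mul_U0ToU_mem_projKer (b : D.U0) {a : D.U} (ha : a ∈ D.projKer) :
    a * D.U0ToU b ∈ D.projKer := by
  refine projKer_induction (p := fun a => a * D.U0ToU b ∈ D.projKer) ha
    (fun a ha => mem_projKer_of_mem_leftIdealLpos (mul_U0ToU_mem_leftIdealLpos ha b))
    (fun ν hν a ha => mem_projKer_of_mem_adWeight hν
      (mul_mem_adWeight ha (U0ToU_mem_adWeight b) (add_zero _).symm))
    (fun a c ha hc => by rw [add_mul]; exact add_mem ha hc)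

lemma exists_sub_mem_projKer (a : D.U) : ∃ z, a - D.U0ToU z ∈ D.projKer := by
  have ha : a ∈ ⨆ ν, D.adWeight ν := by rw [iSup_adWeight]; trivial
  refine Submodule.iSup_induction _ (motive := fun a => ∃ z, a - D.U0ToU z ∈ D.projKer) ha
    (fun ν a ha => ?_) ⟨0, by simp⟩ ?_
  · by_cases hν : ν = 0
    · subst hν
      exact (exists_isHarishChandra ha).imp fun z hz => mem_projKer_of_mem_leftIdealLpos hz.2.1
    · exact ⟨0, by simpa using mem_projKer_of_mem_adWeight hν ha⟩
  · rintro a b ⟨y, hy⟩ ⟨z, hz⟩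
    exact ⟨y + z, by rw [map_add, add_sub_add_comm]; exact add_mem hy hz⟩

/-- `U(L) L_+` is spanned by weight vectors, hence contains its homogeneous components, and adding
other weight spaces does not enlarge its part of weight zero. -/
lemma mem_leftIdealLpos_of_mem_projKer {a : D.U} (ha : a ∈ D.projKer) (ha0 : a ∈ D.adWeight 0) :
    a ∈ D.leftIdealLpos := by
  classical
  let A : Dual k D.H → Submodule k D.U := fun ν =>
    if ν = 0 then D.adWeight 0 ⊓ D.leftIdealLpos.restrictScalars k else D.adWeight ν
  have hA : ∀ ν, A ν ≤ D.adWeight ν := by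
    intro ν
    dsimp only [A]
    split_ifs with h
    · rw [h]; exact inf_le_left
    · exact le_rfl
  have hmem : ∀ ν, ∀ b ∈ D.adWeight ν, b ∈ D.leftIdealLpos → b ∈ ⨆ ν, A ν := by
    intro ν b hb hb'
    refine Submodule.mem_iSup_of_mem ν ?_
    dsimp only [A]
    split_ifs with h
    · exact ⟨h ▸ hb, hb'⟩
    · exact hb
  have hleft : ∀ b ∈ D.leftIdealLpos, b ∈ ⨆ ν, A ν := by
    intro b hb
    obtain ⟨c, rfl⟩ := (Finsupp.mem_span_iff_linearCombination _ _ _).1 hb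
    rw [Finsupp.linearCombination_apply]
    refine Submodule.sum_mem _ fun ⟨_, x, hx, hxe⟩ _ => ?_
    subst hxe
    have hu : c ⟨D.incl x, x, hx, rfl⟩ ∈ ⨆ ν, D.adWeight ν := by rw [iSup_adWeight]; trivial
    generalize c ⟨D.incl x, x, hx, rfl⟩ = u at hu
    change u * D.incl x ∈ _
    refine Submodule.iSup_induction _ (motive := fun u => u * D.incl x ∈ ⨆ ν, A ν) hu
      (fun ν u hu => ?_) (by simp) (fun u v hu hv => by rw [add_mul]; exact add_mem hu hv)
    refine Submodule.iSup_induction _ (motive := fun x => u * D.incl x ∈ ⨆ ν, A ν) hx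
      (fun β x hx => ?_) (by simp) (fun x y hx hy => by rw [incl_add, mul_add]; exact add_mem hx hy)
    refine Submodule.iSup_induction _ (motive := fun x => u * D.incl x ∈ ⨆ ν, A ν) hx
      (fun hβ x hx => ?_) (by simp) (fun x y hx hy => by rw [incl_add, mul_add]; exact add_mem hx hy)
    exact hmem _ _ (mul_mem_adWeight hu (incl_mem_adWeight hx) rfl)
      (mul_mem_leftIdealLpos _ (incl_mem_leftIdealLpos (rootSpace_le_Lpos hβ hx)))
  have ha' : a ∈ ⨆ ν, A ν := by
    refine projKer_induction ha hleft (fun ν hν b hb => ?_) (fun _ _ => add_mem)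
    refine Submodule.mem_iSup_of_mem ν ?_
    dsimp only [A]
    rwa [if_neg hν]
  have := Submodule.mem_of_mem_iSup_of_eigenvector D.adU (wt := fun (χ : Dual k D.H) h => χ h)
    DFunLike.coe_injective A (fun ν _ hv => hA ν hv) ha' ha0
  dsimp only [A] at this
  rw [if_pos rfl] at this
  exact this.2

variable (lam : D.DominantWeight)

lemma mem_seligmanIdeal_of_mem_generators {z : D.U0} (hz : z ∈ seligmanGenerators lam) :
    z ∈ seligmanIdeal lam :=
  TwoSidedIdeal.mem_asIdeal.2 (TwoSidedIdeal.subset_span hz)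

/-- PBW would give `z = 0`. Here it suffices that `π_0` enters `J^λ` through its graph: taking all
`x_j` and `y_j` to be zero, such a `z` is a value of `π_0(0)` and so a generator. If there is no
simple root, then `L = 0` and `z = 0` directly. -/
lemma mem_seligmanIdeal_of_mem_leftIdealLpos {z : D.U0} (hz : D.U0ToU z ∈ D.leftIdealLpos) :
    z ∈ seligmanIdeal lam := by
  rcases isEmpty_or_nonempty D.base.support with h | ⟨⟨i⟩⟩
  · have hL := subsingleton_of_isEmpty h
    have hL0 : Subsingleton D.L0 := inferInstanceAs (Subsingleton (D.L0 : Set L))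
    have h0 : D.U0ToU z = 0 := by
      have : D.leftIdealLpos = ⊥ := by
        rw [leftIdealLpos, Submodule.span_eq_bot]
        rintro _ ⟨x, -, rfl⟩
        rw [Subsingleton.elim x 0, incl_zero]
      rwa [this, Submodule.mem_bot] at hz
    have hid : (UniversalEnvelopingAlgebra.lift k (0 : L →ₗ⁅k⁆ D.U0)).comp D.U0ToU =
        AlgHom.id k D.U0 := by
      apply UniversalEnvelopingAlgebra.hom_ext
      ext x
      rw [Subsingleton.elim x 0, map_zero, map_zero]
    have h1 : UniversalEnvelopingAlgebra.lift k (0 : L →ₗ⁅k⁆ D.U0) (D.U0ToU z) = z :=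
      DFunLike.congr_fun hid z
    rw [← h1, h0, _root_.map_zero]
    exact zero_mem _
  · refine mem_seligmanIdeal_of_mem_generators lam (Or.inl ⟨i, lam.ell i + 1,
      fun _ => D.simpleRoot i, fun _ => 0, fun _ => 0, fun _ => D.simpleRoot_mem_Θpos i,
      fun _ => zero_mem _, by simp, fun _ => zero_mem _, ?_⟩)
    have h0 : (List.ofFn fun _ : Fin (lam.ell i + 1) => D.incl (0 : L)).prod = 0 := by
      simp [List.ofFn_succ]
    rw [h0, zero_mul]
    exact ⟨mem_adWeight_zero.1 (zero_mem _),
      by simpa using hz, mem_adWeight_zero.1 (sub_mem (zero_mem _) (U0ToU_mem_adWeight z))⟩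

/-- The projection of `U(L)` to the Seligman algebra `S^λ`, the composition of the projection onto
`U(L)_0` with the Harish-Chandra homomorphism `π_0` and the quotient map. -/
noncomputable def proj (a : D.U) : Seligman lam :=
  Ideal.Quotient.mk (seligmanIdeal lam) (exists_sub_mem_projKer a).choose

lemma proj_eq {a : D.U} {z : D.U0} (h : a - D.U0ToU z ∈ D.projKer) :
    proj lam a = Ideal.Quotient.mk (seligmanIdeal lam) z := by
  refine (Ideal.Quotient.mk_eq_mk_iff_sub_mem _ _).2
    (mem_seligmanIdeal_of_mem_leftIdealLpos lam
      (mem_leftIdealLpos_of_mem_projKer ?_ (U0ToU_mem_adWeight _)))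
  have := sub_mem h (exists_sub_mem_projKer a).choose_spec
  rwa [sub_sub_sub_cancel_left, ← map_sub] at this

lemma proj_eq_zero {a : D.U} (h : a ∈ D.projKer) : proj lam a = 0 := by
  rw [proj_eq lam (z := 0) (by simpa using h), _root_.map_zero]

lemma proj_U0ToU (b : D.U0) : proj lam (D.U0ToU b) = Ideal.Quotient.mk (seligmanIdeal lam) b :=
  proj_eq lam (by rw [sub_self]; exact zero_mem _)

lemma proj_one : proj lam (1 : D.U) = 1 := by
  rw [← map_one D.U0ToU, proj_U0ToU, map_one]

lemma proj_add (a b : D.U) : proj lam (a + b) = proj lam a + proj lam b := by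
  obtain ⟨y, hy⟩ := exists_sub_mem_projKer a
  obtain ⟨z, hz⟩ := exists_sub_mem_projKer b
  rw [proj_eq lam hy, proj_eq lam hz, ← map_add]
  exact proj_eq lam (by rw [map_add, add_sub_add_comm]; exact add_mem hy hz)

lemma proj_mul_U0ToU (a : D.U) (b : D.U0) :
    proj lam (a * D.U0ToU b) = proj lam a * Ideal.Quotient.mk (seligmanIdeal lam) b := by
  obtain ⟨y, hy⟩ := exists_sub_mem_projKer a
  rw [proj_eq lam hy, ← map_mul]
  exact proj_eq lam (by rw [map_mul, ← sub_mul]; exact mul_U0ToU_mem_projKer b hy)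

lemma proj_U0ToU_mul (a : D.U) (b : D.U0) :
    proj lam (D.U0ToU b * a) = Ideal.Quotient.mk (seligmanIdeal lam) b * proj lam a := by
  obtain ⟨y, hy⟩ := exists_sub_mem_projKer a
  rw [proj_eq lam hy, ← map_mul]
  exact proj_eq lam (by rw [map_mul, ← mul_sub]; exact U0ToU_mul_mem_projKer b hy)

lemma proj_mul_incl (a : D.U) {x : L} (hx : x ∈ D.Lpos) : proj lam (a * D.incl x) = 0 :=
  proj_eq_zero lam (mem_projKer_of_mem_leftIdealLpos
    (mul_mem_leftIdealLpos a (incl_mem_leftIdealLpos hx)))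

lemma proj_posWord_mul {i : D.base.support} {p : D.U}
    (hp : PosWord D ((lam.ell i + 1) • D.simpleRoot i) p) :
    proj lam (p * D.incl (D.f i) ^ (lam.ell i + 1)) = 0 := by
  have hw : p * D.incl (D.f i) ^ (lam.ell i + 1) ∈ D.adWeight 0 :=
    mul_mem_adWeight hp.mem_adWeight
      (pow_mem_adWeight (incl_mem_adWeight (D.coe_f_mem i)) _) (by simp)
  obtain ⟨z, hz⟩ := exists_isHarishChandra hw
  rw [proj_eq lam (mem_projKer_of_mem_leftIdealLpos hz.2.1), Ideal.Quotient.eq_zero_iff_mem]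
  obtain ⟨m, β, x, hβ, hx, hsum, rfl⟩ := hp
  refine mem_seligmanIdeal_of_mem_generators lam (Or.inl ⟨i, m, β, x, fun _ => D.f i, hβ, hx, hsum,
    fun _ => D.coe_f_mem i, ?_⟩)
  rwa [List.ofFn_const, List.prod_replicate]

/-- By the triangular decomposition `a` may be a word `n b p`. Only total weight zero matters. If
`n` is empty, `p` has weight `(ℓ_i + 1) α_i` and a generator of `J^λ` appears. If `n` starts with a
letter of weight `-β`, the remaining product has the positive weight `β`, and so lies in `U(L) L_+`.
-/
lemma proj_mul_f_pow (a : D.U) (i : D.base.support) :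
    proj lam (a * D.incl (D.f i) ^ (lam.ell i + 1)) = 0 := by
  set N := lam.ell i + 1 with hN
  set F := D.incl (D.f i : L) ^ N with hF
  have hFw : F ∈ D.adWeight (N • -D.simpleRoot i) :=
    pow_mem_adWeight (incl_mem_adWeight (D.coe_f_mem i)) _
  have ha : a ∈ ⨆ ν, Submodule.span k {v | TriWord D ν v} := mem_iSup_span_TriWord a
  have hzero : proj lam ((0 : D.U) * F) = 0 := by
    rw [zero_mul]; exact proj_eq_zero lam (zero_mem _)
  have hadd : ∀ a b : D.U, proj lam (a * F) = 0 → proj lam (b * F) = 0 →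
      proj lam ((a + b) * F) = 0 := fun a b ha hb => by rw [add_mul, proj_add, ha, hb, add_zero]
  refine Submodule.iSup_induction _ (motive := fun a => proj lam (a * F) = 0) ha
    (fun ν a ha => ?_) hzero hadd
  refine Submodule.span_induction (p := fun a _ => proj lam (a * F) = 0) ?_ hzero
    (fun a b _ _ => hadd a b) (fun c a _ ha => ?_) ha
  · rintro v ⟨b, δ, p, γ, hp, hv, rfl⟩
    have hg : D.U0ToU b * p ∈ D.adWeight δ := U0ToU_mul_mem_adWeight b hp.mem_adWeight
    by_cases hw : δ - γ + N • -D.simpleRoot i = 0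
    · cases hv with
      | base s hs =>
        rw [Set.mem_singleton_iff.1 hs, mul_assoc, proj_U0ToU_mul]
        have : δ = N • D.simpleRoot i := by
          rw [sub_zero, smul_neg, ← sub_eq_add_neg, sub_eq_zero] at hw
          exact hw
        rw [proj_posWord_mul lam (this ▸ hp), mul_zero]
      | cons β hβ x hx γ v hv =>
        rw [smul_eq_mul, mul_assoc]
        refine proj_eq_zero lam (mem_projKer_of_mem_leftIdealLpos (mul_mem_leftIdealLpos _
          (mem_leftIdealLpos_of_notMem (neg_notMem_posCone hβ) (mul_mem_adWeight
            (hv.mem_adWeight hg) hFw ?_))))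
        rw [← sub_eq_zero, ← neg_eq_zero, ← hw]
        abel
    · exact proj_eq_zero lam (mem_projKer_of_mem_adWeight hw
        (mul_mem_adWeight (hv.mem_adWeight hg) hFw rfl))
  · rw [Algebra.smul_def, mul_assoc, ← AlgHom.commutes D.U0ToU, proj_U0ToU_mul, ha, mul_zero]

end RootGradedLieAlgebra

namespace RootGradedLieAlgebra

attribute [local instance] LieRing.ofAssociativeRing

variable {k L : Type u} [Field k] [CharZero k] [LieRing L] [LieAlgebra k L]
variable (D : RootGradedLieAlgebra k L)

/-! ### Weight spaces of `L`-modules -/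

section Modules

variable {V : Type u} [AddCommGroup V] [Module D.U V]

-- In the Leibniz expansion of `y ^ (p + q) x v` each term has `ad y` applied at least `p` times to
-- `x` or `y` applied at least `q` times to `v`. The double induction on `p` and `q` avoids writing
-- out binomial coefficients.
variable {D} in
lemma exists_incl_pow_smul_eq_zero {y : L} {p : ℕ} : ∀ {q : ℕ} {x : L} {v : V},
    ((LieAlgebra.ad k L y : End k L) ^ p) x = 0 → D.incl y ^ q • v = 0 →
      D.incl y ^ (p + q) • D.incl x • v = 0 := by
  induction p with
  | zero =>
    intro q x v hx _
    rw [show x = 0 by simpa using hx, incl_zero, zero_smul, smul_zero]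
  | succ p ihp =>
    intro q
    induction q with
    | zero =>
      intro x v _ hv
      rw [show v = 0 by simpa using hv, smul_zero, smul_zero]
    | succ q ihq =>
      intro x v hx hv
      rw [← add_assoc, pow_succ, mul_smul, ← mul_smul (D.incl y), incl_mul_incl, add_smul,
        smul_add, mul_smul (D.incl x)]
      have h1 := ihp (q := q + 1) (x := ⁅y, x⁆) (v := v) (by rwa [pow_succ] at hx) hv
      have h2 := ihq (x := x) (v := D.incl y • v) hx (by rwa [← mul_smul, ← pow_succ])
      rw [h2, add_zero, add_right_comm]
      exact h1

variable {D} in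
/-- A root vector that acts nilpotently on generators acts locally nilpotently. -/
lemma exists_pow_smul_eq_zero_of_generators {α : Dual k D.H} (hα : α ≠ 0) {y : L}
    (hy : y ∈ D.rootSpace α) {S : Set V} (hS : Submodule.span D.U S = ⊤)
    (h : ∀ s ∈ S, ∃ n : ℕ, D.incl y ^ n • s = 0) (v : V) : ∃ n : ℕ, D.incl y ^ n • v = 0 := by
  have hadd : ∀ v w : V, (∃ n : ℕ, D.incl y ^ n • v = 0) → (∃ n : ℕ, D.incl y ^ n • w = 0) →
      ∃ n : ℕ, D.incl y ^ n • (v + w) = 0 := by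
    rintro v w ⟨m, hm⟩ ⟨n, hn⟩
    refine ⟨m + n, ?_⟩
    rw [smul_add, pow_add, mul_smul (D.incl y ^ m) _ w, hn, smul_zero, add_zero, ← pow_add,
      add_comm, pow_add, mul_smul, hm, smul_zero]
  have hsmul : ∀ a : D.U, ∀ v : V, (∃ n : ℕ, D.incl y ^ n • v = 0) →
      ∃ n : ℕ, D.incl y ^ n • a • v = 0 := by
    intro a
    induction a using UniversalEnvelopingAlgebra.induction_on with
    | algebraMap c =>
      rintro v ⟨n, hn⟩
      exact ⟨n, by rw [← mul_smul, ← Algebra.commutes, mul_smul, hn, smul_zero]⟩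
    | ι x =>
      rintro v ⟨q, hq⟩
      obtain ⟨p, hp⟩ := exists_ad_pow_eq_zero hα hy x
      exact ⟨p + q, exists_incl_pow_smul_eq_zero hp hq⟩
    | add a b ha hb => intro v hv; rw [add_smul]; exact hadd _ _ (ha v hv) (hb v hv)
    | mul a b ha hb => intro v hv; rw [mul_smul]; exact ha _ (hb v hv)
  have hv : v ∈ Submodule.span D.U S := by rw [hS]; trivial
  exact Submodule.span_induction (p := fun v _ => ∃ n : ℕ, D.incl y ^ n • v = 0) h ⟨0, by simp⟩
    (fun v w _ _ => hadd v w) (fun a v _ => hsmul a v) hv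

lemma simpleRoot_ne_zero (i : D.base.support) : D.simpleRoot i ≠ 0 := by
  obtain ⟨j, hj⟩ := exists_root_eq (D.simpleRoot_mem_Θpos i)
  exact hj ▸ D.Θ.ne_zero j

lemma isIntegrable_of_generators {S : Set V} (hS : Submodule.span D.U S = ⊤)
    (h : ∀ i, ∀ s ∈ S, (∃ n : ℕ, D.incl (D.e i : L) ^ n • s = 0) ∧
      (∃ n : ℕ, D.incl (D.f i : L) ^ n • s = 0)) : D.IsIntegrable V := fun i v =>
  ⟨exists_pow_smul_eq_zero_of_generators (D.simpleRoot_ne_zero i) (D.coe_e_mem i) hS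
    (fun s hs => (h i s hs).1) v,
   exists_pow_smul_eq_zero_of_generators (neg_ne_zero.2 (D.simpleRoot_ne_zero i)) (D.coe_f_mem i)
    hS (fun s hs => (h i s hs).2) v⟩

variable {D}

lemma smul_mem_weightSpace {ν μ : Dual k D.H} {a : D.U} (ha : a ∈ D.adWeight ν) {v : V}
    (hv : v ∈ D.weightSpace V μ) : a • v ∈ D.weightSpace V (μ + ν) := by
  intro h
  have h1 := ha h
  rw [adU_apply, sub_eq_iff_eq_add] at h1
  rw [← mul_smul, h1, add_smul, mul_smul, hv h, ← mul_smul a, ← Algebra.commutes, mul_smul,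
    Algebra.smul_def, mul_smul, ← add_smul, ← map_add, LinearMap.add_apply, add_comm]

variable [Module k V] [IsScalarTower k D.U V]

lemma mem_weightSpace {μ : Dual k D.H} {v : V} :
    v ∈ D.weightSpace V μ ↔ ∀ h : D.H, D.incl ((h : D.g) : L) • v = μ h • v :=
  forall_congr' fun h => by rw [algebraMap_smul]

variable (D V) in
/-- The weight space `V_μ` as a `k`-subspace. -/
def weightSubmodule (μ : Dual k D.H) : Submodule k V :=
  { D.weightSpace V μ with
    smul_mem' := by
      intro c v hv
      change v ∈ D.weightSpace V μ at hv
      change c • v ∈ D.weightSpace V μ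
      rw [mem_weightSpace] at hv ⊢
      intro h
      rw [smul_comm, hv h, smul_comm] }

lemma mem_weightSubmodule {μ : Dual k D.H} {v : V} :
    v ∈ D.weightSubmodule V μ ↔ v ∈ D.weightSpace V μ := Iff.rfl

lemma mem_of_mem_iSup_of_mem_weightSpace {A : Dual k D.H → Submodule k V}
    (hA : ∀ χ, A χ ≤ D.weightSubmodule V χ) {z : V} (hz : z ∈ ⨆ χ, A χ) {μ : Dual k D.H}
    (hzμ : z ∈ D.weightSpace V μ) : z ∈ A μ :=
  Submodule.mem_of_mem_iSup_of_eigenvector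
    (fun h : D.H => Algebra.lsmul k k V (D.incl ((h : D.g) : L)))
    (wt := fun (χ : Dual k D.H) h => χ h) DFunLike.coe_injective A
    (fun χ _ hv => mem_weightSpace.1 (hA χ hv)) hz (mem_weightSpace.1 hzμ)

variable (D V) in
lemma slTwoAction (i : D.base.support) : SlTwoAction
    (Algebra.lsmul k k V (D.incl (D.e i : L))) (Algebra.lsmul k k V (D.incl (D.f i : L)))
    (Algebra.lsmul k k V (D.incl ((D.simpleCoroot i : D.g) : L))) where
  e_f v := by
    have h : ⁅(D.e i : L), (D.f i : L)⁆ = ((D.simpleCoroot i : D.g) : L) :=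
      congrArg (fun x : D.g => (x : L)) (D.lie_e_f i)
    simp only [Algebra.lsmul_coe]
    rw [← mul_smul, incl_mul_incl, h, add_smul, mul_smul, add_comm]
  h_e v := by
    have h := D.coe_e_mem i (D.simpleCoroot i)
    simp only [Algebra.lsmul_coe]
    rw [← mul_smul, incl_mul_incl, h, D.simpleRoot_apply_simpleCoroot, incl_smul, add_smul,
      mul_smul, smul_assoc, add_comm]
  h_f v := by
    have h := D.coe_f_mem i (D.simpleCoroot i)
    simp only [Algebra.lsmul_coe]
    rw [← mul_smul, incl_mul_incl, h, LinearMap.neg_apply, D.simpleRoot_apply_simpleCoroot,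
      incl_smul, add_smul, mul_smul, smul_assoc, neg_smul, add_comm, sub_eq_add_neg]

/-- Integrable `L`-modules are weight modules. -/
lemma IsIntegrable.iSup_weightSubmodule (hV : D.IsIntegrable V) :
    ⨆ μ, D.weightSubmodule V μ = ⊤ := by
  have h1 := Module.End.iSup_iInf_eigenspace_eq_top
    (fun i : D.base.support => Algebra.lsmul k k V (D.incl ((D.simpleCoroot i : D.g) : L)))
    (fun i j => by
      have h2 := D.coe_H_mem_L0 (D.simpleCoroot j) (D.simpleCoroot i)
      have h3 : Commute (D.incl ((D.simpleCoroot i : D.g) : L))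
          (D.incl ((D.simpleCoroot j : D.g) : L)) := by
        rw [commute_iff_eq, incl_mul_incl, h2, LinearMap.zero_apply, zero_smul, incl_zero, zero_add]
      exact h3.map (Algebra.lsmul k k V))
    (fun i => (D.slTwoAction V i).iSup_eigenspace_eq_top
      (fun v => by
        obtain ⟨n, hn⟩ := (hV i v).1
        exact ⟨n, by rw [← map_pow]; exact hn⟩)
      (fun v => by
        obtain ⟨n, hn⟩ := (hV i v).2
        exact ⟨n, by rw [← map_pow]; exact hn⟩))
  rw [eq_top_iff, ← h1]
  refine iSup_le fun χ v hv => ?_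
  -- The simple coroots form a basis of `𝔥`, so any tuple of eigenvalues `χ` is the restriction of a
  -- unique weight.
  refine Submodule.mem_iSup_of_mem (D.base.toCoweightBasis.constr k χ) ?_
  rw [mem_weightSubmodule, mem_weightSpace]
  simp only [Submodule.mem_iInf, End.mem_eigenspace_iff, Algebra.lsmul_coe] at hv
  intro h
  have hh : h ∈ Submodule.span k (Set.range D.simpleCoroot) := by
    rw [D.span_simpleCoroot]; trivial
  induction hh using Submodule.span_induction with
  | mem h hh =>
    obtain ⟨i, rfl⟩ := hh
    have h2 : D.base.toCoweightBasis i = D.simpleCoroot i := D.base.toCoweightBasis_apply i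
    rw [hv i, ← h2, Basis.constr_basis]
  | zero => rw [map_zero, zero_smul]; exact (congrArg (· • v) D.incl_zero).trans (zero_smul _ _)
  | add x y _ _ hx hy =>
    rw [map_add, add_smul, ← hx, ← hy, ← add_smul]
    exact congrArg (· • v) (D.incl_add _ _)
  | smul c x _ hx =>
    rw [_root_.map_smul, smul_assoc, ← hx, ← smul_assoc]
    exact congrArg (· • v) (D.incl_smul _ _)

end Modules

/-! ### The weight space of weight `λ` -/

variable {D}

/-- The weights of `V` lie in `λ - ℕ[Θ₊]`. -/
def IsBounded (lam : D.DominantWeight) (V : Type u) [AddCommGroup V] [Module D.U V] : Prop :=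
  ∀ μ : Dual k D.H, D.weightSpace V μ ≠ ⊥ → lam.wt - μ ∈ D.posCone

section Restriction

variable {lam : D.DominantWeight} {V : Type u} [AddCommGroup V] [Module D.U V]

lemma IsBounded.eq_zero (hV : IsBounded lam V) {μ : Dual k D.H} (hμ : lam.wt - μ ∉ D.posCone)
    {v : V} (hv : v ∈ D.weightSpace V μ) : v = 0 := by
  have h := not_not.1 fun h => hμ (hV μ h)
  rwa [h, AddSubgroup.mem_bot] at hv

lemma IsBounded.incl_smul_eq_zero (hV : IsBounded lam V) {v : V}
    (hv : v ∈ D.weightSpace V lam.wt) {x : L} (hx : x ∈ D.Lpos) : D.incl x • v = 0 := by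
  have hadd : ∀ x y : L, D.incl x • v = 0 → D.incl y • v = 0 → D.incl (x + y) • v = 0 :=
    fun x y hx hy => by rw [incl_add, add_smul, hx, hy, add_zero]
  have h0 : D.incl 0 • v = 0 := by rw [incl_zero, zero_smul]
  refine Submodule.iSup_induction _ (motive := fun x => D.incl x • v = 0) hx
    (fun β x hx => ?_) h0 hadd
  refine Submodule.iSup_induction _ (motive := fun x => D.incl x • v = 0) hx
    (fun hβ x hx => ?_) h0 hadd
  exact hV.eq_zero (by simpa using neg_notMem_posCone hβ)
    (smul_mem_weightSpace (incl_mem_adWeight hx) hv)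

lemma IsBounded.smul_eq_zero (hV : IsBounded lam V) {v : V}
    (hv : v ∈ D.weightSpace V lam.wt) {a : D.U} (ha : a ∈ D.leftIdealLpos) : a • v = 0 := by
  refine Submodule.span_induction (p := fun a _ => a • v = 0) ?_ (zero_smul _ _)
    (fun a b _ _ ha hb => by rw [add_smul, ha, hb, add_zero])
    (fun b a _ ha => by rw [smul_assoc, ha, smul_zero]) ha
  rintro _ ⟨x, hx, rfl⟩
  exact hV.incl_smul_eq_zero hv hx

/-- The weight `s_i(λ + α_i) = λ - (ℓ_i + 1) α_i` does not occur in `V`. -/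
lemma IsBounded.eq_zero_of_mem_weightSpace (hV : IsBounded lam V) (hint : D.IsIntegrable V)
    (i : D.base.support) {w : V}
    (hw : w ∈ D.weightSpace V (lam.wt + (lam.ell i + 1) • -D.simpleRoot i)) : w = 0 := by
  let _ : Module k V := Module.compHom V (algebraMap k D.U)
  have : IsScalarTower k D.U V := ⟨fun c a v => by rw [Algebra.smul_def, mul_smul]; rfl⟩
  obtain ⟨p, hp⟩ := (hint i w).2
  -- The eigenvalue of `h_i` is `ℓ_i - 2 (ℓ_i + 1) = -(ℓ_i + 2)`, and `e_i ^ (ℓ_i + 2)` leads to the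
  -- weight `λ + α_i`, which does not occur.
  refine (D.slTwoAction V i).eq_zero_of_e_pow_eq_zero p (lam.ell i + 2) w ?_
    (by rw [← map_pow]; exact hp) ?_
  · refine (mem_weightSpace.1 hw _).trans ?_
    congr 1
    simp only [LinearMap.add_apply, LinearMap.smul_apply, LinearMap.neg_apply,
      lam.apply_simpleCoroot, D.simpleRoot_apply_simpleCoroot]
    push_cast [nsmul_eq_mul]
    ring
  · rw [← map_pow]
    refine hV.eq_zero (μ := lam.wt + D.simpleRoot i)
      (by simpa using neg_notMem_posCone (D.simpleRoot_mem_Θpos i)) ?_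
    have := smul_mem_weightSpace
      (pow_mem_adWeight (incl_mem_adWeight (D.coe_e_mem i)) (lam.ell i + 2)) hw
    rw [smul_neg, add_assoc, show lam.ell i + 2 = (lam.ell i + 1) + 1 from rfl,
      succ_nsmul _ (lam.ell i + 1), neg_add_cancel_left] at this
    exact this

lemma list_prod_mem_adWeight {ν : Dual k D.H} (n : ℕ) (y : Fin n → L)
    (hy : ∀ j, y j ∈ D.rootSpace ν) :
    (List.ofFn fun j => D.incl (y j)).prod ∈ D.adWeight (n • ν) := by
  induction n with
  | zero => intro h; simp [adU_apply]
  | succ n ih =>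
    rw [List.ofFn_succ, List.prod_cons]
    exact mul_mem_adWeight (incl_mem_adWeight (hy 0)) (ih _ fun j => hy j.succ)
      (succ_nsmul' _ _)

/-- The annihilator is a two-sided ideal, so generators suffice. For the first kind, the factor `y_1
⋯ y_{ℓ_i + 1}` already maps `V_λ` into a zero weight space, while the difference between the product
and `z` is in `U(L) L_+` and kills `V_λ`. -/
lemma IsBounded.isTorsionBySet (hV : IsBounded lam V) (hint : D.IsIntegrable V) :
    Module.IsTorsionBySet D.U0 (D.weightSpace V lam.wt) (seligmanIdeal lam) := by
  have hle : TwoSidedIdeal.span (seligmanGenerators lam) ≤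
      TwoSidedIdeal.ker (Module.toAddMonoidEnd D.U0 (D.weightSpace V lam.wt)) := by
    rw [TwoSidedIdeal.span_le]
    intro z hz
    rw [SetLike.mem_coe, TwoSidedIdeal.mem_ker]
    refine AddMonoidHom.ext fun v => Subtype.ext ?_
    change D.U0ToU z • (v : V) = 0
    rcases hz with ⟨i, m, β, x, y, -, -, -, hy, hz⟩ | ⟨i, rfl⟩
    · have h1 := hV.smul_eq_zero v.2 hz.2.1
      have h2 := hV.eq_zero_of_mem_weightSpace hint i
        (smul_mem_weightSpace (list_prod_mem_adWeight _ y hy) v.2)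
      rwa [sub_smul, mul_smul, h2, smul_zero, zero_sub, neg_eq_zero] at h1
    · rw [map_sub, U0ToU_ι, map_natCast, sub_smul, cartanToL0, v.2, lam.apply_simpleCoroot,
        map_natCast, sub_self]
  rintro v ⟨z, hz⟩
  have := hle (TwoSidedIdeal.mem_asIdeal.1 hz)
  rw [TwoSidedIdeal.mem_ker] at this
  exact DFunLike.congr_fun this v

lemma IsBounded.f_pow_smul_eq_zero (hV : IsBounded lam V) (hint : D.IsIntegrable V) {v : V}
    (hv : v ∈ D.weightSpace V lam.wt) (i : D.base.support) :
    D.incl (D.f i : L) ^ (lam.ell i + 1) • v = 0 :=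
  hV.eq_zero_of_mem_weightSpace hint i (smul_mem_weightSpace
    (pow_mem_adWeight (incl_mem_adWeight (D.coe_f_mem i)) _) hv)

/-! ### Quotients of modules in `I^λ` -/

variable {W : Type u} [AddCommGroup W] [Module D.U W]

lemma isIntegrable_of_surjective (hint : D.IsIntegrable V) {φ : V →ₗ[D.U] W}
    (hφ : Function.Surjective φ) : D.IsIntegrable W := by
  intro i w
  obtain ⟨v, rfl⟩ := hφ w
  obtain ⟨⟨m, hm⟩, n, hn⟩ := hint i v
  exact ⟨⟨m, by rw [← map_smul, hm, map_zero]⟩, n, by rw [← map_smul, hn, map_zero]⟩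

/-- Surjections of integrable modules are surjective on weight spaces. -/
lemma exists_mem_weightSpace_of_surjective (hint : D.IsIntegrable V) {φ : V →ₗ[D.U] W}
    (hφ : Function.Surjective φ) {μ : Dual k D.H} {w : W} (hw : w ∈ D.weightSpace W μ) :
    ∃ v ∈ D.weightSpace V μ, φ v = w := by
  let _ : Module k V := Module.compHom V (algebraMap k D.U)
  have : IsScalarTower k D.U V := ⟨fun c a v => by rw [Algebra.smul_def, mul_smul]; rfl⟩
  let _ : Module k W := Module.compHom W (algebraMap k D.U)
  have : IsScalarTower k D.U W := ⟨fun c a v => by rw [Algebra.smul_def, mul_smul]; rfl⟩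
  obtain ⟨v, rfl⟩ := hφ w
  have h1 : φ v ∈ ⨆ χ, (D.weightSubmodule V χ).map (φ.restrictScalars k) := by
    rw [← Submodule.map_iSup, hint.iSup_weightSubmodule]
    exact ⟨v, trivial, rfl⟩
  refine mem_of_mem_iSup_of_mem_weightSpace (fun χ => ?_) h1 hw
  rintro _ ⟨v, hv, rfl⟩
  rw [mem_weightSubmodule]
  intro h
  rw [LinearMap.restrictScalars_apply, ← map_smul, hv h, map_smul]

lemma isBounded_of_surjective (hint : D.IsIntegrable V) (hV : IsBounded lam V) {φ : V →ₗ[D.U] W}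
    (hφ : Function.Surjective φ) : IsBounded lam W := by
  intro μ hμ
  refine hV μ fun h => hμ ?_
  rw [AddSubgroup.eq_bot_iff_forall] at h ⊢
  intro w hw
  obtain ⟨v, hv, rfl⟩ := exists_mem_weightSpace_of_surjective hint hφ hw
  rw [h v hv, map_zero]

end Restriction

/-! ### The induced module -/

section Induction

variable (lam : D.DominantWeight) {M : Type u} [AddCommGroup M] [Module (Seligman lam) M]

lemma smul_intMk (a b : D.U) (m : M) : a • intMk lam b m = intMk lam (a * b) m := rfl

lemma intMk_eq_smul (a : D.U) (m : M) : intMk lam a m = a • intMk lam 1 m := by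
  rw [smul_intMk, mul_one]

lemma intMk_add (a : D.U) (m n : M) : intMk lam a (m + n) = intMk lam a m + intMk lam a n := by
  simp [intMk, TensorProduct.tmul_add]

lemma intMk_zero (a : D.U) : intMk lam a (0 : M) = 0 := by
  simp [intMk]

lemma intMk_mul_U0ToU (a : D.U) (b : D.U0) (m : M) :
    intMk lam (a * D.U0ToU b) m = intMk lam a (Ideal.Quotient.mk (seligmanIdeal lam) b • m) := by
  rw [intMk, intMk, ← sub_eq_zero, ← map_sub, ← map_sub]
  have : (a * D.U0ToU b) ⊗ₜ[ℤ] m - a ⊗ₜ[ℤ] (Ideal.Quotient.mk (seligmanIdeal lam) b • m) ∈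
      balancing lam M := Submodule.subset_span (Or.inl ⟨a, b, m, rfl⟩)
  rw [← (balancing lam M).ker_mkQ, LinearMap.mem_ker] at this
  rw [this, map_zero]

lemma intMk_mul_incl (a : D.U) {x : L} (hx : x ∈ D.Lpos) (m : M) :
    intMk lam (a * D.incl x) m = 0 := by
  have : (a * D.incl x) ⊗ₜ[ℤ] m ∈ balancing lam M :=
    Submodule.subset_span (Or.inr ⟨a, x, m, hx, rfl⟩)
  rw [← (balancing lam M).ker_mkQ, LinearMap.mem_ker] at this
  rw [intMk, this, map_zero]

lemma intMk_f_pow (i : D.base.support) (m : M) :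
    intMk lam (D.incl (D.f i : L) ^ (lam.ell i + 1)) m = 0 := by
  refine (Submodule.Quotient.mk_eq_zero _).2 ?_
  exact Submodule.mem_iSup_of_mem i (Submodule.mem_iSup_of_mem m (Submodule.subset_span rfl))

variable (M) in
lemma span_intMk : Submodule.span D.U (Set.range (intMk lam (1 : D.U) (M := M))) = ⊤ := by
  rw [Submodule.eq_top_iff']
  intro t
  obtain ⟨t, rfl⟩ := Submodule.mkQ_surjective _ t
  obtain ⟨t, rfl⟩ := Submodule.mkQ_surjective _ t
  induction t using TensorProduct.induction_on with
  | zero => simp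
  | tmul a m =>
    change intMk lam a m ∈ _
    rw [intMk_eq_smul]
    exact Submodule.smul_mem _ _ (Submodule.subset_span ⟨m, rfl⟩)
  | add x y hx hy => rw [map_add, map_add]; exact add_mem hx hy

variable (M) in
lemma isIntegrable_intInduced : D.IsIntegrable (IntInduced lam M) := by
  refine D.isIntegrable_of_generators (span_intMk lam M) ?_
  rintro i _ ⟨m, rfl⟩
  refine ⟨⟨1, ?_⟩, lam.ell i + 1, ?_⟩
  · rw [pow_one, smul_intMk, mul_one, ← one_mul (D.incl _)]
    exact intMk_mul_incl lam 1 (rootSpace_le_Lpos (D.simpleRoot_mem_Θpos i) (D.coe_e_mem i)) m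
  · rw [smul_intMk, mul_one, intMk_f_pow]

/-- The elements `h - λ(h)` for `h ∈ 𝔥` lie in `J^λ`. -/
lemma mk_cartan (h : D.H) : Ideal.Quotient.mk (seligmanIdeal lam)
    (UniversalEnvelopingAlgebra.ι k (D.cartanToL0 h)) =
      Ideal.Quotient.mk (seligmanIdeal lam) (algebraMap k D.U0 (lam.wt h)) := by
  rw [Ideal.Quotient.mk_eq_mk_iff_sub_mem]
  let F : D.H →ₗ[k] D.U0 := (UniversalEnvelopingAlgebra.ι k (L := D.L0)).toLinearMap.comp
    ({ toFun := D.cartanToL0, map_add' := fun _ _ => rfl, map_smul' := fun _ _ => rfl } :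
      D.H →ₗ[k] D.L0) -
    (Algebra.linearMap k D.U0).comp lam.wt
  have hle : (⊤ : Submodule k D.H) ≤ ((seligmanIdeal lam).restrictScalars k).comap F := by
    rw [← D.span_simpleCoroot, Submodule.span_le]
    rintro _ ⟨i, rfl⟩
    refine mem_seligmanIdeal_of_mem_generators lam (Or.inr ⟨i, ?_⟩)
    change _ - algebraMap k D.U0 (lam.wt (D.simpleCoroot i)) = _
    rw [lam.apply_simpleCoroot, map_natCast]
    rfl
  exact hle (Submodule.mem_top : h ∈ ⊤)

lemma intMk_one_mem_weightSpace (m : M) :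
    intMk lam 1 m ∈ D.weightSpace (IntInduced lam M) lam.wt := by
  intro h
  have h1 : D.incl ((h : D.g) : L) = 1 * D.U0ToU (UniversalEnvelopingAlgebra.ι k (D.cartanToL0 h)) := by
    rw [U0ToU_ι, one_mul]; rfl
  rw [smul_intMk, smul_intMk, mul_one, h1, intMk_mul_U0ToU, mk_cartan, ← intMk_mul_U0ToU,
    AlgHom.commutes, one_mul, mul_one]

/-- `I(M)` is spanned by the words in `L_-` applied to `1 ⊗ M`. -/
lemma mem_negSpan_intInduced (t : IntInduced lam M) :
    t ∈ D.negSpan (Set.range (intMk lam (1 : D.U) (M := M))) := by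
  set S := Set.range (intMk lam (1 : D.U) (M := M)) with hS
  have ht : t ∈ Submodule.span D.U S := by rw [span_intMk]; trivial
  induction ht using Submodule.span_induction with
  | mem x hx => exact Submodule.subset_span ⟨0, .base x hx⟩
  | zero => exact zero_mem _
  | add x y _ _ hx hy => exact add_mem hx hy
  | smul a x _ hx =>
    refine D.smul_mem_negSpan ?_ ?_ a hx
    · rintro x hx _ ⟨m, rfl⟩
      refine Submodule.subset_span
        ⟨Ideal.Quotient.mk (seligmanIdeal lam) (UniversalEnvelopingAlgebra.ι k (⟨x, hx⟩ : D.L0)) • m, ?_⟩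
      rw [← intMk_mul_U0ToU, U0ToU_ι, one_mul, smul_intMk, mul_one]
    · rintro β hβ x hx _ ⟨m, rfl⟩
      rw [smul_intMk, mul_one, ← one_mul (D.incl x),
        intMk_mul_incl lam 1 (rootSpace_le_Lpos hβ hx)]
      exact zero_mem _

/-- Words in `L_-` on `1 ⊗ M` span and are weight vectors, so independence of weight spaces selects
those of degree `λ - μ`. Both the bound on the weights and the surjectivity of `ξ_M` follow. -/
lemma mem_span_of_mem_weightSpace {μ : Dual k D.H} {t : IntInduced lam M}
    (ht : t ∈ D.weightSpace (IntInduced lam M) μ) : t ∈ Submodule.span k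
      {v | NegWord D (Set.range (intMk lam (1 : D.U) (M := M))) (lam.wt - μ) v} := by
  refine mem_of_mem_iSup_of_mem_weightSpace (A := fun μ => Submodule.span k
      {v | NegWord D (Set.range (intMk lam (1 : D.U) (M := M))) (lam.wt - μ) v}) ?_ ?_ ht
  · intro χ
    refine Submodule.span_le.2 fun v hv => ?_
    rw [SetLike.mem_coe, mem_weightSubmodule, mem_weightSpace]
    intro h
    have := NegWord.apply_eq_smul (μ := lam.wt) hv
      (fun h : D.H => Algebra.lsmul k k (IntInduced lam M) (D.incl ((h : D.g) : L)))
      (fun h x v => by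
        simp only [Algebra.lsmul_coe]
        rw [← mul_smul, incl_mul_incl, add_smul, mul_smul, add_comm])
      (by
        rintro _ ⟨m, rfl⟩
        exact mem_weightSpace.1 (intMk_one_mem_weightSpace lam m)) h
    rwa [sub_sub_cancel] at this
  · refine (Submodule.span_le.2 ?_ : D.negSpan _ ≤ _) (mem_negSpan_intInduced lam t)
    rintro v ⟨γ, hv⟩
    refine Submodule.mem_iSup_of_mem (lam.wt - γ) (Submodule.subset_span ?_)
    change NegWord D _ _ v
    rwa [sub_sub_cancel]

variable (M) in
lemma isBounded_intInduced : IsBounded lam (IntInduced lam M) := by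
  intro μ hμ
  obtain ⟨t, ht, ht0⟩ := (D.weightSpace (IntInduced lam M) μ).bot_or_exists_ne_zero.resolve_left hμ
  have h1 := mem_span_of_mem_weightSpace lam ht
  by_contra hcon
  refine ht0 ?_
  have h2 : {v | NegWord D (Set.range (intMk lam (1 : D.U) (M := M))) (lam.wt - μ) v} = ∅ :=
    Set.eq_empty_of_forall_notMem fun v hv => hcon (NegWord.mem_posCone hv)
  rwa [h2, Submodule.span_empty, Submodule.mem_bot] at h1

lemma exists_intMk_eq {t : IntInduced lam M}
    (ht : t ∈ D.weightSpace (IntInduced lam M) lam.wt) : ∃ m, intMk lam 1 m = t := by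
  refine Submodule.span_induction (p := fun t _ => ∃ m, intMk lam 1 m = t) (fun v hv => ?_)
    ⟨0, intMk_zero lam 1⟩ ?_ ?_ (mem_span_of_mem_weightSpace lam ht)
  · change NegWord D _ _ v at hv
    exact Set.mem_range.1 (hv.mem_of_eq_zero (sub_self _))
  · rintro _ _ - - ⟨m, rfl⟩ ⟨n, rfl⟩
    exact ⟨m + n, intMk_add lam 1 m n⟩
  · rintro c _ - ⟨m, rfl⟩
    refine ⟨Ideal.Quotient.mk (seligmanIdeal lam) (algebraMap k D.U0 c) • m, ?_⟩
    rw [← intMk_mul_U0ToU, AlgHom.commutes, one_mul, ← algebraMap_smul D.U c, smul_intMk, mul_one]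

/-- The projection of `U(L) ⊗ M` onto `M`. -/
noncomputable def tensorProj : D.U ⊗[ℤ] M →+ M :=
  TensorProduct.liftAddHom
    (AddMonoidHom.mk' (fun a => DistribSMul.toAddMonoidHom M (proj lam a)) fun a b => by
      ext m; simp [proj_add, add_smul])
    (fun r a m => by rw [map_zsmul, map_zsmul]; rfl)

lemma tensorProj_tmul (a : D.U) (m : M) : tensorProj lam (a ⊗ₜ[ℤ] m) = proj lam a • m := rfl

/-- The map `tensorProj` is only additive, so it is compared with the relations through `Q`, the
largest `U(L)`-submodule in its kernel. Both families of relations lie in `Q`, so `1 ⊗ (m - n)` does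
too once its class in `I(M)` vanishes, and `tensorProj` sends it to `m - n`. -/
lemma intMk_injective : Function.Injective (intMk lam (1 : D.U) (M := M)) := by
  let Q : Submodule D.U (D.U ⊗[ℤ] M) :=
    { carrier := {t | ∀ a : D.U, tensorProj lam (a • t) = 0}
      zero_mem' := by simp
      add_mem' := fun ha hb c => by rw [smul_add, map_add, ha, hb, add_zero]
      smul_mem' := fun c t ht a => by rw [smul_smul]; exact ht _ }
  have hbal : balancing lam M ≤ Q := by
    refine Submodule.span_le.2 ?_
    rintro _ (⟨a, b, m, rfl⟩ | ⟨a, x, m, hx, rfl⟩) c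
    · rw [smul_sub, map_sub, TensorProduct.smul_tmul', TensorProduct.smul_tmul', smul_eq_mul,
        smul_eq_mul, tensorProj_tmul, tensorProj_tmul, ← mul_assoc, proj_mul_U0ToU, mul_smul,
        sub_self]
    · rw [TensorProduct.smul_tmul', smul_eq_mul, tensorProj_tmul, ← mul_assoc, proj_mul_incl lam _ hx,
        zero_smul]
  have hrel : inducedRel lam M ≤ Q.map (balancing lam M).mkQ := by
    refine iSup_le fun i => iSup_le fun m => Submodule.span_le.2 ?_
    rintro _ rfl
    refine ⟨_, fun c => ?_, rfl⟩
    rw [TensorProduct.smul_tmul', smul_eq_mul, tensorProj_tmul, proj_mul_f_pow, zero_smul]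
  intro m n hmn
  have h1 : intMk lam 1 (m - n) = 0 := by
    have := intMk_add lam (1 : D.U) (m - n) n
    rwa [sub_add_cancel, hmn, right_eq_add] at this
  obtain ⟨q, hq, hq'⟩ := hrel ((Submodule.Quotient.mk_eq_zero _).1 h1)
  have h2 : (1 : D.U) ⊗ₜ[ℤ] (m - n) ∈ Q := by
    have h3 : (1 : D.U) ⊗ₜ[ℤ] (m - n) - q ∈ balancing lam M := by
      rw [← Submodule.Quotient.mk_eq_zero, Submodule.Quotient.mk_sub, sub_eq_zero]
      exact hq'.symm
    rw [← sub_add_cancel ((1 : D.U) ⊗ₜ[ℤ] (m - n)) q]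
    exact add_mem (hbal h3) hq
  have h4 := h2 1
  rwa [one_smul, tensorProj_tmul, proj_one, one_smul, sub_eq_zero] at h4

variable {V : Type u} [AddCommGroup V] [Module D.U V]

/-- The universal property of `I(M)`. -/
noncomputable def intLift (g : M →+ V)
    (hg : ∀ (b : D.U0) m, g (Ideal.Quotient.mk (seligmanIdeal lam) b • m) = D.U0ToU b • g m)
    (hpos : ∀ x ∈ D.Lpos, ∀ m, D.incl x • g m = 0)
    (hf : ∀ i m, D.incl (D.f i : L) ^ (lam.ell i + 1) • g m = 0) :
    IntInduced lam M →ₗ[D.U] V := by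
  let T : D.U ⊗[ℤ] M →ₗ[D.U] V := TensorProduct.AlgebraTensorModule.lift
      { toFun := fun a => ((DistribSMul.toAddMonoidHom V a).comp g).toIntLinearMap
        map_add' := fun a b => LinearMap.ext fun m => add_smul a b (g m)
        map_smul' := fun a b => LinearMap.ext fun m => mul_smul a b (g m) }
  have hT : ∀ a m, T (a ⊗ₜ[ℤ] m) = a • g m := fun a m => rfl
  refine (inducedRel lam M).liftQ ((balancing lam M).liftQ T ?_) ?_
  · refine Submodule.span_le.2 ?_
    rintro _ (⟨a, b, m, rfl⟩ | ⟨a, x, m, hx, rfl⟩)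
    · rw [SetLike.mem_coe, LinearMap.mem_ker, map_sub, hT, hT, hg, mul_smul, sub_self]
    · rw [SetLike.mem_coe, LinearMap.mem_ker, hT, mul_smul, hpos x hx, smul_zero]
  · refine iSup_le fun i => iSup_le fun m => Submodule.span_le.2 ?_
    rintro _ rfl
    exact hf i m

end Induction

end RootGradedLieAlgebra

namespace RootGradedLieAlgebra

attribute [local instance] LieRing.ofAssociativeRing

variable {k L : Type u} [Field k] [CharZero k] [LieRing L] [LieAlgebra k L]
variable {D : RootGradedLieAlgebra k L}

/-! ### The adjunction -/

lemma restrictionWellDefined (lam : D.DominantWeight) : RestrictionWellDefined lam :=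
  fun _ hV => IsBounded.isTorsionBySet hV.2 hV.1

lemma inductionWellDefined (lam : D.DominantWeight) : InductionWellDefined lam :=
  fun M => ⟨isIntegrable_intInduced lam M, isBounded_intInduced lam M⟩

variable (lam : D.DominantWeight) (hR : RestrictionWellDefined lam) (hI : InductionWellDefined lam)

lemma restrictionIncl_injective (V : IntCat lam) :
    Function.Injective (restrictionIncl lam hR V) := Subtype.val_injective

lemma restrictionIncl_mem (V : IntCat lam) (v : (restriction lam hR).obj V) :
    restrictionIncl lam hR V v ∈ D.weightSpace V.obj lam.wt :=
  Subtype.prop (p := fun w : V.obj => w ∈ D.weightSpace V.obj lam.wt) v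

lemma exists_restrictionIncl_eq (V : IntCat lam) {w : V.obj}
    (hw : w ∈ D.weightSpace V.obj lam.wt) : ∃ v, restrictionIncl lam hR V v = w :=
  ⟨(⟨w, hw⟩ : D.weightSpace V.obj lam.wt), rfl⟩

lemma restrictionIncl_add (V : IntCat lam) (v w : (restriction lam hR).obj V) :
    restrictionIncl lam hR V (v + w) =
      restrictionIncl lam hR V v + restrictionIncl lam hR V w := rfl

lemma restrictionIncl_smul (V : IntCat lam) (b : D.U0) (v : (restriction lam hR).obj V) :
    restrictionIncl lam hR V (Ideal.Quotient.mk (seligmanIdeal lam) b • v) =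
      D.U0ToU b • restrictionIncl lam hR V v := rfl

lemma restrictionIncl_map {V W : IntCat lam} (φ : V ⟶ W) (v : (restriction lam hR).obj V) :
    restrictionIncl lam hR W (((restriction lam hR).map φ).hom v) =
      φ.hom.hom (restrictionIncl lam hR V v) := rfl

lemma induction_map_intMk {M N : ModuleCat.{u} (Seligman lam)} (f : M ⟶ N) (a : D.U) (m : M) :
    ((induction lam hI).map f).hom.hom (intMk lam a m) = intMk lam a (f.hom m) :=
  intInducedMap_intMk lam f.hom a m

/-- The map `ξ_M : M → I(M)_λ`. -/
noncomputable def unitMap (M : ModuleCat.{u} (Seligman lam)) :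
    M →ₗ[Seligman lam] (restriction lam hR).obj ((induction lam hI).obj M) where
  toFun m := (⟨intMk lam 1 m, intMk_one_mem_weightSpace lam m⟩ :
    D.weightSpace (IntInduced lam M) lam.wt)
  map_add' m n := restrictionIncl_injective lam hR ((induction lam hI).obj M) (intMk_add lam 1 m n)
  map_smul' s m := by
    obtain ⟨b, rfl⟩ := Ideal.Quotient.mk_surjective s
    refine restrictionIncl_injective lam hR ((induction lam hI).obj M) ?_
    change intMk lam 1 (Ideal.Quotient.mk (seligmanIdeal lam) b • m) =
      D.U0ToU b • intMk lam 1 m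
    rw [← intMk_mul_U0ToU, one_mul, smul_intMk, mul_one]

lemma unitMap_bijective (M : ModuleCat.{u} (Seligman lam)) :
    Function.Bijective (unitMap lam hR hI M) := by
  refine ⟨fun m n h => intMk_injective lam ?_, fun v => ?_⟩
  · exact congrArg (restrictionIncl lam hR ((induction lam hI).obj M)) h
  · obtain ⟨m, hm⟩ := exists_intMk_eq lam
      (restrictionIncl_mem lam hR ((induction lam hI).obj M) v)
    exact ⟨m, restrictionIncl_injective lam hR _ hm⟩

/-- The isomorphism `ξ : Id ≅ R ∘ I`. -/
noncomputable def unitIso :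
    𝟭 (ModuleCat.{u} (Seligman lam)) ≅ induction lam hI ⋙ restriction lam hR :=
  NatIso.ofComponents
    (fun M => (LinearEquiv.ofBijective _ (unitMap_bijective lam hR hI M)).toModuleIso)
    (fun f => ModuleCat.hom_ext (LinearMap.ext fun m =>
      restrictionIncl_injective lam hR _ (induction_map_intMk lam hI f 1 m).symm))

/-- The map `η_V : I(V_λ) → V`. -/
noncomputable def counitMap (V : IntCat lam) :
    IntInduced lam ((restriction lam hR).obj V) →ₗ[D.U] V.obj :=
  intLift lam (AddMonoidHom.mk' (restrictionIncl lam hR V) (restrictionIncl_add lam hR V))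
    (restrictionIncl_smul lam hR V)
    (fun _ hx v => IsBounded.incl_smul_eq_zero V.property.2 (restrictionIncl_mem lam hR V v) hx)
    (fun i v => IsBounded.f_pow_smul_eq_zero V.property.2 V.property.1
      (restrictionIncl_mem lam hR V v) i)

lemma counitMap_intMk (V : IntCat lam) (a : D.U) (v : (restriction lam hR).obj V) :
    counitMap lam hR V (intMk lam a v) = a • restrictionIncl lam hR V v := rfl

lemma range_counitMap (V : IntCat lam) : LinearMap.range (counitMap lam hR V) =
    Submodule.span D.U (D.weightSpace V.obj lam.wt : Set V.obj) := by
  rw [LinearMap.range_eq_map, ← span_intMk, Submodule.map_span, ← Set.range_comp]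
  congr 1
  ext w
  constructor
  · rintro ⟨v, rfl⟩
    rw [Function.comp_apply, counitMap_intMk, one_smul]
    exact restrictionIncl_mem lam hR V v
  · intro hw
    obtain ⟨v, rfl⟩ := exists_restrictionIncl_eq lam hR V hw
    exact ⟨v, by rw [Function.comp_apply, counitMap_intMk, one_smul]⟩

/-- The natural transformation `η : I ∘ R ⇒ Id`. -/
noncomputable def counitTrans : restriction lam hR ⋙ induction lam hI ⟶ 𝟭 (IntCat lam) where
  app V := ObjectProperty.homMk (ModuleCat.ofHom (counitMap lam hR V))
  naturality V W φ := by
    refine ObjectProperty.hom_ext _ (ModuleCat.hom_ext (intInduced_hom_ext lam fun a v => ?_))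
    change counitMap lam hR W (((induction lam hI).map ((restriction lam hR).map φ)).hom.hom
      (intMk lam a v)) = φ.hom.hom (counitMap lam hR V (intMk lam a v))
    rw [induction_map_intMk, counitMap_intMk, counitMap_intMk, restrictionIncl_map, map_smul]

/-- The adjunction between `I` and `R`. -/
noncomputable def inductionAdjunction : induction lam hI ⊣ restriction lam hR :=
  Adjunction.mkOfUnitCounit
    { unit := (unitIso lam hR hI).hom
      counit := counitTrans lam hR hI
      left_triangle := by
        ext M : 2
        refine ObjectProperty.hom_ext _ (ModuleCat.hom_ext (intInduced_hom_ext lam fun a m => ?_))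
        change counitMap lam hR ((induction lam hI).obj M) (((induction lam hI).map
          ((unitIso lam hR hI).hom.app M)).hom.hom (intMk lam a m)) = intMk lam a m
        rw [induction_map_intMk, counitMap_intMk]
        exact (intMk_eq_smul lam a m).symm
      right_triangle := by
        ext V : 2
        refine ModuleCat.hom_ext (LinearMap.ext fun v => restrictionIncl_injective lam hR V ?_)
        exact one_smul D.U (restrictionIncl lam hR V v) }

/-- Epimorphisms in `I^λ` are surjective. -/
lemma surjective_of_epi {V W : IntCat lam} (φ : V ⟶ W) [Epi φ] :
    Function.Surjective φ.hom.hom := by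
  let N := LinearMap.range φ.hom.hom
  have hN := N.mkQ_surjective
  -- The cokernel of `φ` lies again in `I^λ`, so the quotient map and the zero map out of `W` can be
  -- compared there.
  let Q : IntCat lam := ⟨ModuleCat.of D.U (W.obj ⧸ N),
    isIntegrable_of_surjective W.property.1 hN,
    isBounded_of_surjective W.property.1 W.property.2 hN⟩
  let π : W ⟶ Q := ObjectProperty.homMk (ModuleCat.ofHom N.mkQ)
  let z : W ⟶ Q := ObjectProperty.homMk (ModuleCat.ofHom (0 : W.obj →ₗ[D.U] (W.obj ⧸ N)))
  have h : π = z := by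
    rw [← cancel_epi φ]
    refine ObjectProperty.hom_ext _ (ModuleCat.hom_ext (LinearMap.ext fun v => ?_))
    exact (Submodule.Quotient.mk_eq_zero N).2 ⟨v, rfl⟩
  intro w
  have h1 : N.mkQ w = 0 := congrArg (fun ψ : W ⟶ Q => ψ.hom.hom w) h
  exact (Submodule.Quotient.mk_eq_zero N).1 h1

/-- This is the condition on the right adjoint under which the left adjoint `I` preserves projective
objects. -/
lemma preservesEpimorphisms_restriction : (restriction lam hR).PreservesEpimorphisms where
  preserves {V W} φ _ := by
    rw [ModuleCat.epi_iff_surjective]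
    intro w
    obtain ⟨v, hv, hvw⟩ := exists_mem_weightSpace_of_surjective V.property.1
      (surjective_of_epi lam φ) (restrictionIncl_mem lam hR W w)
    obtain ⟨v, rfl⟩ := exists_restrictionIncl_eq lam hR V hv
    exact ⟨v, restrictionIncl_injective lam hR W hvw⟩

end RootGradedLieAlgebra

open RootGradedLieAlgebra
theorem proposition4p7 {k L : Type u} [Field k] [CharZero k] [LieRing L] [LieAlgebra k L]
    (D : RootGradedLieAlgebra k L) (lam : D.DominantWeight) :
    -- `R` and `I` are well defined
    ∃ (hR : RestrictionWellDefined lam) (hI : InductionWellDefined lam),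
    -- `ξ : Id ≅ R ∘ I` and the natural transformation `η : I ∘ R ⇒ Id`
    ∃ (ξ : 𝟭 (ModuleCat.{u} (Seligman lam)) ≅ induction lam hI ⋙ restriction lam hR)
      (η : restriction lam hR ⋙ induction lam hI ⟶ 𝟭 (IntCat lam)),
      -- `ξ_M (m)` is the class of `1 ⊗ m`
      (∀ (M : ModuleCat.{u} (Seligman lam)) (m : M),
        restrictionIncl lam hR ((induction lam hI).obj M) ((ξ.hom.app M).hom m) = intMk lam 1 m) ∧
      -- `η_V` maps the class of `a ⊗ v` to `a v`, and its image is `U(L) V_λ`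
      (∀ (V : IntCat lam) (a : D.U) (v : (restriction lam hR).obj V),
        (η.app V).hom.hom (intMk lam a v) = a • restrictionIncl lam hR V v) ∧
      (∀ V : IntCat lam, LinearMap.range (η.app V).hom.hom =
        Submodule.span D.U (D.weightSpace V.obj lam.wt : Set V.obj)) ∧
      -- `R` is right adjoint to `I`, with unit `ξ` and counit `η`
      (∃ adj : induction lam hI ⊣ restriction lam hR, adj.unit = ξ.hom ∧ adj.counit = η) ∧
      -- `I` preserves projective objects
      (∀ M : ModuleCat.{u} (Seligman lam), CategoryTheory.Projective M →
        CategoryTheory.Projective ((induction lam hI).obj M)) ∧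
      -- `I` preserves cyclic modules and surjective homomorphisms
      (∀ M : ModuleCat.{u} (Seligman lam), (∃ m : M, Submodule.span (Seligman lam) {m} = ⊤) →
        ∃ w : ((induction lam hI).obj M).obj, Submodule.span D.U {w} = ⊤) ∧
      (∀ (M N : ModuleCat.{u} (Seligman lam)) (f : M ⟶ N), Function.Surjective f.hom →
        Function.Surjective ((induction lam hI).map f).hom.hom) := by
  have hR := restrictionWellDefined lam
  have hI := inductionWellDefined lam
  refine ⟨hR, hI, unitIso lam hR hI, counitTrans lam hR hI, fun M m => rfl, fun V a v => rfl,
    fun V => range_counitMap lam hR V, ⟨inductionAdjunction lam hR hI, rfl, rfl⟩, ?_, ?_, ?_⟩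
  · intro M hM
    have := preservesEpimorphisms_restriction lam hR
    exact (inductionAdjunction lam hR hI).map_projective M hM
  · rintro M ⟨m, hm⟩
    refine ⟨intMk lam 1 m, ?_⟩
    change Submodule.span D.U {(intMk lam 1 m : IntInduced lam M)} = ⊤
    rw [eq_top_iff]
    refine (span_intMk lam M).ge.trans (Submodule.span_le.2 ?_)
    rintro _ ⟨n, rfl⟩
    have hn : n ∈ Submodule.span (Seligman lam) {m} := hm ▸ Submodule.mem_top
    obtain ⟨s, rfl⟩ := Submodule.mem_span_singleton.1 hn
    obtain ⟨b, rfl⟩ := Ideal.Quotient.mk_surjective s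
    -- The scalar from `S^λ` lifts to `b ∈ U(L_0)` and moves across the tensor sign, so `1 ⊗ m`
    -- generates all of `1 ⊗ M`.
    rw [← intMk_mul_U0ToU, one_mul, intMk_eq_smul lam (D.U0ToU b)]
    exact (Submodule.span D.U {(intMk lam 1 m : IntInduced lam M)}).smul_mem _
      (Submodule.subset_span rfl)
  · intro M N f hf
    change Function.Surjective (intInducedMap lam f.hom)
    rw [← LinearMap.range_eq_top, eq_top_iff]
    refine (span_intMk lam N).ge.trans (Submodule.span_le.2 ?_)
    rintro _ ⟨n, rfl⟩
    obtain ⟨m, rfl⟩ := hf n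
    exact ⟨intMk lam 1 m, induction_map_intMk lam hI f 1 m⟩
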